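/- **Setting.** A finite discounted MDP $\mathcal M=(\mathcal S,\{\mathcal A^s\}_{s\in\mathcal S},p,r,\gamma)$ has rewards $r(s,a,s')\in[0,1]$ and discount factor $\gamma\in(0,1)$. A policy $\pi$ maps each state $s$ to an action in $\mathcal A^s$, $V^\pi_{\mathcal M}(s)=\mathbb E^\pi[\sum_{t\ge0}\gamma^t r(s_t,a_t,s_{t+1})\mid s_0=s]$, $V^*_{\mathcal M}(s)=\max_\pi V^\pi_{\mathcal M}(s)$ and $Q^*_{\mathcal M}(s,a)=\sum_{s'}p(s'|s,a)\,(r(s,a,s')+\gamma V^*_{\mathcal M}(s'))$. The policy $\pi$ is $\varepsilon$-optimal if $V_{\mathcal M}^\pi(s)\ge V_{\mathcal M}^*(s)-\varepsilon$ for all $s$. Let $\mathcal S'$ be the set of states with more than one available action. Let $\mathcal A^s_{\mathcal M}(c)=\{a: V^*_{\mathcal M}(s)-Q^*_{\mathcal M}(s,a)<c\}$ if $c>0$, and $\mathcal A^s_{\mathcal M}(c)=\arg\max_a Q^*_{\mathcal M}(s,a)$ if $c\le0$. For MDPs with the same $\mathcal S$, $\{\mathcal A^s\}$ and $\gamma$,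 let $d_{TV}(\mathcal M_0,\mathcal M)=\max\{\max_{s,a}\|p_0(\cdot|s,a)-p(\cdot|s,a)\|_1,\ \|r_0-r\|_\infty\}$ and $B_{TV}(\mathcal M_0,\beta)=\{\mathcal M: d_{TV}(\mathcal M_0,\mathcal M)\le\beta\}$. An algorithm is randomized and adaptive: given all samples so far, it either calls a generative model at a pair $(s,a)$ of its choice, which returns $(s',r(s,a,s'))$ with probability $p(s'|s,a)$ (one sample), or it stops and outputs a policy. It is $(\mathcal M_0,\beta,\varepsilon,\delta)$-correct if for every $\mathcal M\in B_{TV}(\mathcal M_0,\beta)$, run on the generative model of $\mathcal M$, it outputs an $\varepsilon$-optimal policy for $\mathcal M$ with probability at least $1-\delta$. **Prior models.** Let $\beta\in(0,2)$, $\gamma\in(\max\{0.4,1-10\beta\},1)$, $K\ge1$ and $L\ge2$. The states are $x_k$, $y_1(x_k,a_l)$ and $y_2(x_k,a_l)$ for $1\le k\le K$, $1\le l\le L$. Each $x_k$ has the $L$ actions $a_1,\dots,a_L$, and all other states have a single action. Taking $a_l$ at $x_k$ leads to $y_1(x_k,a_l)$ with probability $1$. The state $y_1(x_k,a_l)$ moves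 to itself with probability $p_0(x_k,a_l)\in[0,1)$ and to the absorbing state $y_2(x_k,a_l)$ otherwise. The reward is $1$ if the next state is one of the states $y_1(\cdot,\cdot)$, and $0$ otherwise. Let $\mathcal M_0$ be any such MDP with $\max_l p_0(x_k,a_l)>\frac{4\gamma-1}{3\gamma}$ for every $k$. Write $V^*=V^*_{\mathcal M_0}$. **Theorem 2 (lower bound).** There is a universal constant $c>0$ such that the following holds for all $\beta,\gamma,K,L$ and $\mathcal M_0$ as above. Let $0<\varepsilon<\varepsilon_0$ and $0<\delta<1/40$, where $$\varepsilon_0=\frac{\beta\gamma\min_{s\in\mathcal S'}V^*(s)^2}{16}\min\Big(\frac{\beta}{2},\frac{1-\gamma}{3\gamma}\Big),$$ and let $$\underline C_s=\begin{cases}V^*(s)-\dfrac{9}{12(1-\gamma)-64(1-\gamma)^2\varepsilon+4.5\beta\gamma},&\text{if }\dfrac\beta2+\dfrac{4\gamma-1}{3\gamma}\ge1;\\[2mm] V^*(s)-\dfrac{V^*(s)^2}{V^*(s)+\beta\gamma V^*(s)^2+4\varepsilon(1+\gamma\beta V^*(s)/2)^2},&\text{otherwise.}\end{cases}$$ Then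 for every $(\mathcal M_0,\beta,\varepsilon,\delta)$-correct algorithm there is an $\mathcal M\in B_{TV}(\mathcal M_0,\beta)$ on which the expected number of samples it draws is at least $$c\cdot\frac{\sum_{s}|\mathcal A^s_{\mathcal M_0}(\underline C_s)|}{(1-\gamma)^3\varepsilon^2}\log\frac1\delta,$$ where the sum is over the states $s\in\mathcal S'$ with $|\mathcal A^s_{\mathcal M_0}(\underline C_s)|\ge2$; this is all of $\mathcal S'$ unless some state has a single action in $\mathcal A^s_{\mathcal M_0}(\underline C_s)$. -/

import Mathlib

namespace TransferRL

/-! ### Discounted Markov decision processes -/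

/-- A finite discounted MDP with state space `S`, sets `A s` of available actions, and discount
factor `γ`. Two MDPs that are compared share `S`, `A` and `γ`, so these are parameters. -/
structure MDP (S : Type*) [Fintype S] (A : S → Type*) (γ : ℝ) where
  /-- `p s a s'` is the probability of moving from `s` to `s'` under the action `a`. -/
  p : (s : S) → A s → S → ℝ
  /-- `r s a s'` is the reward of the transition. -/
  r : (s : S) → A s → S → ℝ
  p_nonneg : ∀ s a s', 0 ≤ p s a s'
  p_sum : ∀ s a, ∑ s', p s a s' = 1
  r_mem : ∀ s a s', r s a s' ∈ Set.Icc (0 : ℝ) 1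

/-- A policy maps each state to one of its available actions. -/
abbrev Policy {S : Type*} (A : S → Type*) := (s : S) → A s

/-- The set `S'` of the states that have more than one available action. -/
def multiActionStates {S : Type*} (A : S → Type*) : Set S := {s | Nontrivial (A s)}

namespace MDP

variable {S : Type*} [Fintype S] {A : S → Type*} {γ : ℝ}

/-- The next-state distribution, as a probability mass function. -/
noncomputable def transPMF (M : MDP S A γ) (s : S) (a : A s) : PMF S :=
  PMF.ofFintype (fun s' => ENNReal.ofReal (M.p s a s')) (by
    rw [← ENNReal.ofReal_sum_of_nonneg (fun s' _ => M.p_nonneg s a s'), M.p_sum s a,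
      ENNReal.ofReal_one])

/-- The transition matrix of the Markov chain that follows `π`. -/
def chainMatrix (M : MDP S A γ) (π : Policy A) : Matrix S S ℝ :=
  Matrix.of fun s s' => M.p s (π s) s'

/-- The expected instant reward in the state `s` under `π`. -/
def meanReward (M : MDP S A γ) (π : Policy A) (s : S) : ℝ :=
  ∑ s', M.p s (π s) s' * M.r s (π s) s'

/-- The value `V^π(s) = E^π [∑ₜ γ^t r(sₜ, aₜ, sₜ₊₁) | s₀ = s]`; the entry `(s, x)` of the `t`-th
power of the transition matrix is the probability that `sₜ = x` given `s₀ = s`. -/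
noncomputable def value [DecidableEq S] (M : MDP S A γ) (π : Policy A) (s : S) : ℝ :=
  ∑' t : ℕ, γ ^ t * ∑ x, (M.chainMatrix π ^ t) s x * M.meanReward π x

/-- The optimal value `V*(s)`, the largest value over the (finitely many) policies. -/
noncomputable def optValue [DecidableEq S] (M : MDP S A γ) (s : S) : ℝ :=
  ⨆ π : Policy A, M.value π s

/-- The optimal action-value function `Q*(s, a)`. -/
noncomputable def optQ [DecidableEq S] (M : MDP S A γ) (s : S) (a : A s) : ℝ :=
  ∑ s', M.p s a s' * (M.r s a s' + γ * M.optValue s')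

/-- `π` is `ε`-optimal for `M`. -/
def IsEpsOptimal [DecidableEq S] (M : MDP S A γ) (ε : ℝ) (π : Policy A) : Prop :=
  ∀ s, M.optValue s - ε ≤ M.value π s

/-- The set of near-optimal actions at `s` with gap less than `c`; the set of optimal actions
when `c ≤ 0`. -/
noncomputable def nearOptActions [DecidableEq S] (M : MDP S A γ) (s : S) (c : ℝ) : Set (A s) :=
  open Classical in
  if 0 < c then {a | M.optValue s - M.optQ s a < c} else {a | ∀ b, M.optQ s b ≤ M.optQ s a}

/-- The distance between MDPs with the same states, actions and discount factor: the larger of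
the maximal `ℓ¹` distance of the transition distributions and the sup distance of the rewards. -/
noncomputable def tvDist (M₀ M : MDP S A γ) : ℝ :=
  max (⨆ x : (s : S) × A s, ∑ s', |M₀.p x.1 x.2 s' - M.p x.1 x.2 s'|)
    (⨆ x : ((s : S) × A s) × S, |M₀.r x.1.1 x.1.2 x.2 - M.r x.1.1 x.1.2 x.2|)

/-- The ball `B_TV(M₀, β)`. -/
def tvBall (M₀ : MDP S A γ) (β : ℝ) : Set (MDP S A γ) := {M | M₀.tvDist M ≤ β}

end MDP

/-! ### Algorithms with access to a generative model -/

/-- One answered call to the generative model. -/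
structure Sample (S : Type*) (A : S → Type*) where
  state : S
  action : A state
  next : S
  reward : ℝ

/-- What an algorithm does next: call the generative model at `(s, a)`, or stop and output a
policy. -/
inductive Decision (S : Type*) (A : S → Type*)
  | query (s : S) (a : A s)
  | output (π : Policy A)

/-- A randomized, adaptive algorithm: the law of the next decision given all samples so far. -/
abbrev Algorithm (S : Type*) (A : S → Type*) := List (Sample S A) → PMF (Decision S A)

/-- The status of a run: still running, or stopped with an output, together with the list of all
samples that have been drawn. -/
inductive Status (S : Type*) (A : S → Type*)
  | running (h : List (Sample S A))
  | stopped (h : List (Sample S A)) (π : Policy A)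

/-- The number of samples drawn so far. -/
def Status.numSamples {S : Type*} {A : S → Type*} : Status S A → ℕ
  | .running h => h.length
  | .stopped h _ => h.length

namespace Algorithm

variable {S : Type*} [Fintype S] {A : S → Type*} {γ : ℝ}

/-- One round of the interaction of the algorithm with the generative model of `M`. -/
noncomputable def step (alg : Algorithm S A) (M : MDP S A γ) : Status S A → PMF (Status S A)
  | .running h => (alg h).bind fun d =>
      match d with
      | .query s a => (M.transPMF s a).map fun s' => .running (h ++ [⟨s, a, s', M.r s a s'⟩])
      | .output π => PMF.pure (.stopped h π)
  | .stopped h π => PMF.pure (.stopped h π)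

/-- The law of the status after `n` rounds. -/
noncomputable def run (alg : Algorithm S A) (M : MDP S A γ) : ℕ → PMF (Status S A)
  | 0 => PMF.pure (.running [])
  | n + 1 => (alg.run M n).bind (alg.step M)

/-- The probability that the algorithm stops and outputs a policy in `E`, when the samples come
from `M`: the limit of the nondecreasing probabilities that this happens within `n` rounds. -/
noncomputable def outputProb (alg : Algorithm S A) (M : MDP S A γ) (E : Set (Policy A)) :
    ENNReal :=
  ⨆ n, (alg.run M n).toOuterMeasure {c | ∃ h, ∃ π ∈ E, c = .stopped h π}

/-- The expected total number of samples that the algorithm draws from `M` (possibly infinite):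
the limit of the nondecreasing expected numbers of samples within `n` rounds. -/
noncomputable def expectedSamples (alg : Algorithm S A) (M : MDP S A γ) : ENNReal :=
  ⨆ n, ∑' c, alg.run M n c * (c.numSamples : ENNReal)

/-- The algorithm is `(M₀, β, ε, δ)`-correct: for every `M` in the ball it outputs an
`ε`-optimal policy for `M` with probability at least `1 - δ`. -/
def IsCorrect [DecidableEq S] (alg : Algorithm S A) (M₀ : MDP S A γ) (β ε δ : ℝ) : Prop :=
  ∀ M ∈ M₀.tvBall β, ENNReal.ofReal (1 - δ) ≤ alg.outputProb M {π | M.IsEpsOptimal ε π}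

end Algorithm

/-! ### The family of prior models -/

/-- The states: `K` states `x k`, and for each `k` and each of the `L` actions `l` a state
`y₁ k l` and a state `y₂ k l`. -/
inductive ChainState (K L : ℕ)
  | x (k : Fin K)
  | y₁ (k : Fin K) (l : Fin L)
  | y₂ (k : Fin K) (l : Fin L)
  deriving DecidableEq, Fintype

/-- There are `L` actions at each `x k` and one action at each other state. -/
def ChainAction (K L : ℕ) : ChainState K L → Type
  | .x _ => Fin L
  | .y₁ _ _ => Unit
  | .y₂ _ _ => Unit

/-- From `x k` the action `l` leads to `y₁ k l`; the state `y₁ k l` has a self-loop of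
probability `q k l` and otherwise moves to `y₂ k l`, which is absorbing. -/
def chainProb {K L : ℕ} (q : Fin K → Fin L → ℝ) :
    (s : ChainState K L) → ChainAction K L s → ChainState K L → ℝ
  | .x k, l, s' => if s' = .y₁ k l then 1 else 0
  | .y₁ k l, _, s' => if s' = .y₁ k l then q k l else if s' = .y₂ k l then 1 - q k l else 0
  | .y₂ k l, _, s' => if s' = .y₂ k l then 1 else 0

/-- The reward is `1` when the next state is one of the states `y₁ k l`, and `0` otherwise. -/
def chainReward {K L : ℕ} : ChainState K L → ℝ
  | .y₁ _ _ => 1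
  | _ => 0

/-- The chain MDP with the self-loop probabilities `q k l`. -/
def chainMDP {K L : ℕ} (γ : ℝ) (q : Fin K → Fin L → ℝ)
    (hq : ∀ k l, q k l ∈ Set.Ico (0 : ℝ) 1) :
    MDP (ChainState K L) (ChainAction K L) γ where
  p := chainProb q
  r _ _ s' := chainReward s'
  p_nonneg s a s' := by
    cases s with
    | x k => simp only [chainProb]; split_ifs <;> norm_num
    | y₁ k l =>
      have h1 := (hq k l).1
      have h2 := (hq k l).2
      simp only [chainProb]
      split_ifs <;> linarith
    | y₂ k l => simp only [chainProb]; split_ifs <;> norm_num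
  p_sum s a := by
    cases s with
    | x k => simp [chainProb]
    | y₁ k l =>
      have h : ∀ s' : ChainState K L, chainProb q (.y₁ k l) a s' =
          (if s' = .y₁ k l then q k l else 0) + (if s' = .y₂ k l then 1 - q k l else 0) := by
        intro s'
        cases s' <;> simp [chainProb]
      simp [h, Finset.sum_add_distrib]
    | y₂ k l => simp [chainProb]
  r_mem s a s' := by
    cases s' <;> simp [chainReward]

/-! ### The constants of the lower bound -/

/-- The threshold `ε₀`, in terms of `β`, `γ` and the optimal values `V*` of the prior model at
the states with more than one action. -/
noncomputable def epsZero {S : Type*} [Fintype S] [DecidableEq S] {A : S → Type*} {γ : ℝ}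
    (M₀ : MDP S A γ) (β : ℝ) : ℝ :=
  β * γ * (⨅ s : multiActionStates A, M₀.optValue s ^ 2) / 16 * min (β / 2) ((1 - γ) / (3 * γ))

/-- The gap threshold at a state whose optimal value in the prior model is `v`. -/
noncomputable def lowerGap (β γ ε v : ℝ) : ℝ :=
  if 1 ≤ β / 2 + (4 * γ - 1) / (3 * γ) then
    v - 9 / (12 * (1 - γ) - 64 * (1 - γ) ^ 2 * ε + 4.5 * β * γ)
  else
    v - v ^ 2 / (v + β * γ * v ^ 2 + 4 * ε * (1 + γ * β * v / 2) ^ 2)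

/-- The number of actions at `s` that are near-optimal in the prior model, for the gap threshold
at `s`. -/
noncomputable def numNearOpt {S : Type*} [Fintype S] [DecidableEq S] {A : S → Type*} {γ : ℝ}
    (M₀ : MDP S A γ) (β ε : ℝ) (s : S) : ℕ :=
  (M₀.nearOptActions s (lowerGap β γ ε (M₀.optValue s))).ncard

/-- The sum of the numbers of near-optimal actions over the states with more than one action,
where a state is counted only if it has more than one near-optimal action. -/
noncomputable def totalNearOpt {S : Type*} [Fintype S] [DecidableEq S] {A : S → Type*} {γ : ℝ}
    (M₀ : MDP S A γ) (β ε : ℝ) : ℕ :=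
  open Classical in
  ∑ s with s ∈ multiActionStates A ∧ 2 ≤ numNearOpt M₀ β ε s, numNearOpt M₀ β ε s

end TransferRL

open TransferRL

/-! One model `M` in the ball is hard for all counted states at once. In it, every near-optimal
action at a state `x k` has exactly the same value `1 / (1 - γ * u)`, and the other actions have at
most that value. To get this tie, the self-loop probability of a near-optimal action is moved
towards a common level `u`. If the budget `β / 2` does not suffice to come down to `u`, the rewards
earned after the action are also scaled by a factor in `[1 - β, 1]`. `IsLevel` collects what `u` and
an increment `η` must satisfy, and `exists_isLevel` finds them in both cases of `lowerGap`, whose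
formula is the condition that `u + η` can be reached.

Raising the self-loop of one near-optimal action `l` by `η` stays in the ball and makes `l` better
than its rivals by more than `ε` (`IsLevel.lt_raisedValue`), so a correct algorithm outputs `l`
there with probability at least `1 - δ`. In `M` itself the events of outputting different actions at
`x k` are disjoint, so all but at most one of them have probability at most `1/2`
(`outputProb_le_half_or`). For each such `l`, a change of measure (`log_le_mul_expectedVisits`)
shows that `M` needs of order `log (1 / δ) / κ` samples at `y₁ k l`, where `κ`, of order `ε ^ 2 * (1
- γ) ^ 3`, bounds the relative entropy of one transition there. These samples are drawn at different
states, so the bounds add up. -/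

namespace TransferRL

open scoped ENNReal

/-! ### Expectations of nonnegative functions under a probability mass function -/

/-- The expectation of a nonnegative function under a probability mass function. -/
noncomputable def lmean {α : Type*} (p : PMF α) (g : α → ℝ≥0∞) : ℝ≥0∞ := ∑' a, p a * g a

section lmean

variable {α α' : Type*}

theorem lmean_pure (a : α) (g : α → ℝ≥0∞) : lmean (PMF.pure a) g = g a := by
  unfold lmean
  rw [tsum_eq_single a]
  · simp
  · intro b hb
    simp [PMF.pure_apply, hb]

theorem lmean_bind (p : PMF α) (f : α → PMF α') (g : α' → ℝ≥0∞) :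
    lmean (p.bind f) g = lmean p fun a => lmean (f a) g := by
  simp only [lmean, PMF.bind_apply, ← ENNReal.tsum_mul_right, ← ENNReal.tsum_mul_left]
  rw [ENNReal.tsum_comm]
  simp only [mul_assoc]

theorem lmean_map (p : PMF α) (f : α → α') (g : α' → ℝ≥0∞) :
    lmean (p.map f) g = lmean p fun a => g (f a) := by
  rw [PMF.map, lmean_bind]
  simp only [Function.comp, lmean_pure]

theorem lmean_add (p : PMF α) (f g : α → ℝ≥0∞) :
    (lmean p fun a => f a + g a) = lmean p f + lmean p g := by
  simp only [lmean, mul_add, ENNReal.tsum_add]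

theorem lmean_const_mul (p : PMF α) (x : ℝ≥0∞) (g : α → ℝ≥0∞) :
    (lmean p fun a => x * g a) = x * lmean p g := by
  simp only [lmean, ← ENNReal.tsum_mul_left, mul_left_comm]

theorem lmean_finsetSum {ι : Type*} (p : PMF α) (F : Finset ι) (g : ι → α → ℝ≥0∞) :
    (lmean p fun a => ∑ i ∈ F, g i a) = ∑ i ∈ F, lmean p (g i) := by
  classical
  induction F using Finset.induction_on with
  | empty => simp [lmean]
  | insert i F hi ih => simp only [Finset.sum_insert hi, lmean_add, ih]

theorem lmean_mono (p : PMF α) {f g : α → ℝ≥0∞} (h : ∀ a, f a ≤ g a) : lmean p f ≤ lmean p g :=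
  ENNReal.tsum_le_tsum fun a => by gcongr; exact h a

theorem lmean_const (p : PMF α) (x : ℝ≥0∞) : (lmean p fun _ => x) = x := by
  simp [lmean, ENNReal.tsum_mul_right, p.tsum_coe]

theorem toOuterMeasure_eq_lmean (p : PMF α) (s : Set α) :
    p.toOuterMeasure s = lmean p (s.indicator 1) := by
  rw [PMF.toOuterMeasure_apply, lmean]
  congr 1
  ext a
  by_cases h : a ∈ s <;> simp [h]

theorem toOuterMeasure_add_compl (p : PMF α) (s : Set α) :
    p.toOuterMeasure s + p.toOuterMeasure sᶜ = 1 := by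
  rw [toOuterMeasure_eq_lmean, toOuterMeasure_eq_lmean, ← lmean_add,
    ← lmean_const p 1]
  congr 1
  ext a
  by_cases h : a ∈ s <;> simp [h]

end lmean

/-! ### Histories, visit counts and likelihood ratios -/

/-- The list of the samples drawn so far. -/
def Status.history {S : Type*} {A : S → Type*} : Status S A → List (Sample S A)
  | .running h => h
  | .stopped h _ => h

/-- The number of samples drawn at the state `s`. -/
def visits {S : Type*} [DecidableEq S] {A : S → Type*} (s : S) (h : List (Sample S A)) : ℕ :=
  h.countP fun x => x.state = s

/-- The likelihood ratio of a history, when `w s a s'` is the ratio of the probabilities of a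
transition. -/
def likelihood {S : Type*} {A : S → Type*} (w : (s : S) → A s → S → ℝ)
    (h : List (Sample S A)) : ℝ :=
  (h.map fun x => w x.state x.action x.next).prod

theorem sum_visits {S : Type*} [Fintype S] [DecidableEq S] {A : S → Type*}
    (h : List (Sample S A)) : ∑ s, visits s h = h.length := by
  induction h with
  | nil => simp [visits]
  | cons x h ih =>
    simp only [visits, List.countP_cons, Finset.sum_add_distrib, List.length_cons] at ih ⊢
    simp [ih]

theorem likelihood_pos {S : Type*} {A : S → Type*} {w : (s : S) → A s → S → ℝ}
    (hw : ∀ s a s', 0 < w s a s') (h : List (Sample S A)) : 0 < likelihood w h := by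
  apply List.prod_pos
  simp only [List.mem_map]
  rintro _ ⟨x, -, rfl⟩
  exact hw _ _ _

theorem lmean_transPMF {S : Type*} [Fintype S] {A : S → Type*} {γ : ℝ} (M : MDP S A γ) (s : S)
    (a : A s) (g : S → ℝ≥0∞) :
    lmean (M.transPMF s a) g = ∑ s', ENNReal.ofReal (M.p s a s') * g s' := by
  simp [lmean, MDP.transPMF, tsum_fintype]

/-! ### Monotone expectations along a run -/

namespace Algorithm

variable {S : Type*} [Fintype S] {A : S → Type*} {γ : ℝ}

theorem lmean_step_running (alg : Algorithm S A) (M : MDP S A γ) (h : List (Sample S A))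
    (g : Status S A → ℝ≥0∞) :
    lmean (alg.step M (.running h)) g = lmean (alg h) fun d =>
      match d with
      | .query s a =>
          lmean (M.transPMF s a) fun s' => g (.running (h ++ [⟨s, a, s', M.r s a s'⟩]))
      | .output π => g (.stopped h π) := by
  rw [step, lmean_bind]
  congr 1
  ext d
  cases d with
  | query s a => simp only [lmean_map]
  | output π => simp only [lmean_pure]

/-- A nonnegative function of the status that does not decrease on average along each query and
when the algorithm stops has nondecreasing expectations along the run. -/
theorem monotone_lmean_run (alg : Algorithm S A) (M : MDP S A γ) {g : Status S A → ℝ≥0∞}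
    (hq : ∀ h s a, g (.running h) ≤
      lmean (M.transPMF s a) fun s' => g (.running (h ++ [⟨s, a, s', M.r s a s'⟩])))
    (ho : ∀ h π, g (.running h) ≤ g (.stopped h π)) :
    Monotone fun n => lmean (alg.run M n) g := by
  refine monotone_nat_of_le_succ fun n => ?_
  simp only [run, lmean_bind]
  refine lmean_mono _ fun c => ?_
  cases c with
  | stopped h π => simp only [step, lmean_pure]; exact le_rfl
  | running h =>
    rw [lmean_step_running, ← lmean_const (alg h) (g (.running h))]
    refine lmean_mono _ fun d => ?_
    cases d with
    | query s a => exact hq h s a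
    | output π => exact ho h π

theorem monotone_outputWithin (alg : Algorithm S A) (M : MDP S A γ) (E : Set (Policy A)) :
    Monotone fun n =>
      (alg.run M n).toOuterMeasure {c | ∃ h, ∃ π ∈ E, c = .stopped h π} := by
  simp only [toOuterMeasure_eq_lmean]
  apply monotone_lmean_run <;> intros <;> simp

/-- The expected number of samples drawn at `s`. -/
noncomputable def expectedVisits [DecidableEq S] (alg : Algorithm S A) (M : MDP S A γ) (s : S) :
    ℝ≥0∞ :=
  ⨆ n, lmean (alg.run M n) fun c => (visits s c.history : ℝ≥0∞)

theorem monotone_visits [DecidableEq S] (alg : Algorithm S A) (M : MDP S A γ) (s : S) :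
    Monotone fun n => lmean (alg.run M n) fun c => (visits s c.history : ℝ≥0∞) := by
  apply monotone_lmean_run
  · intro h s₁ a
    conv_lhs => rw [← lmean_const (M.transPMF s₁ a) (visits s _ : ℝ≥0∞)]
    refine lmean_mono _ fun s' => ?_
    simp [Status.history, visits]
  · intro h π
    simp [Status.history]

theorem sum_expectedVisits_le [DecidableEq S] (alg : Algorithm S A) (M : MDP S A γ)
    (F : Finset S) : ∑ s ∈ F, alg.expectedVisits M s ≤ alg.expectedSamples M := by
  simp only [expectedVisits, expectedSamples]
  rw [ENNReal.finsetSum_iSup_of_monotone fun s => monotone_visits alg M s]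
  refine iSup_mono fun n => ?_
  rw [← lmean_finsetSum]
  refine lmean_mono _ fun c => ?_
  have h1 : ∑ s ∈ F, visits s c.history ≤ c.numSamples := by
    calc ∑ s ∈ F, visits s c.history ≤ ∑ s, visits s c.history :=
          Finset.sum_le_univ_sum_of_nonneg fun _ => Nat.zero_le _
      _ = c.numSamples := by rw [sum_visits]; cases c <;> rfl
  exact_mod_cast h1

theorem outputProb_mono (alg : Algorithm S A) (M : MDP S A γ) {E E' : Set (Policy A)}
    (h : E ⊆ E') : alg.outputProb M E ≤ alg.outputProb M E' := by
  refine iSup_mono fun n => (alg.run M n).toOuterMeasure.mono ?_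
  rintro c ⟨h', π, hπ, rfl⟩
  exact ⟨h', π, h hπ, rfl⟩

/-- Of two disjoint sets of policies, one is output with probability at most `1/2`. -/
theorem outputProb_le_half_or (alg : Algorithm S A) (M : MDP S A γ) {E E' : Set (Policy A)}
    (h : Disjoint E E') : alg.outputProb M E ≤ 2⁻¹ ∨ alg.outputProb M E' ≤ 2⁻¹ := by
  by_contra! hc
  obtain ⟨h1, h2⟩ := hc
  obtain ⟨n, hn⟩ := lt_iSup_iff.1 h1
  obtain ⟨m, hm⟩ := lt_iSup_iff.1 h2
  have hn' := hn.trans_le (monotone_outputWithin alg M E (le_max_left n m))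
  have hm' := hm.trans_le (monotone_outputWithin alg M E' (le_max_right n m))
  have hsub : {c : Status S A | ∃ h, ∃ π ∈ E', c = .stopped h π} ⊆
      {c : Status S A | ∃ h, ∃ π ∈ E, c = .stopped h π}ᶜ := by
    rintro c ⟨h₁, π, hπ, rfl⟩ ⟨h₂, π', hπ', he⟩
    cases he
    exact Set.disjoint_left.1 h hπ' hπ
  have hm'' := hm'.trans_le ((alg.run M (max n m)).toOuterMeasure.mono hsub)
  have := ENNReal.add_lt_add hn' hm''
  rw [ENNReal.inv_two_add_inv_two] at this
  exact this.ne' (toOuterMeasure_add_compl _ _)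

/-! ### Change of measure -/

section ChangeOfMeasure

variable {M₀ M₁ : MDP S A γ} {w : (s : S) → A s → S → ℝ}

/-- The law of the decision depends only on the history and is common to both models, so it cancels;
a query multiplies the likelihood by exactly the ratio `w`. The equality `hr` is needed because
samples record rewards. Here `M₀` is any base model; in the application it is the tied model, not
the prior one. -/
theorem step_likelihood (alg : Algorithm S A) (hw : ∀ s a s', 0 < w s a s')
    (hp : ∀ s a s', M₁.p s a s' = w s a s' * M₀.p s a s') (hr : M₁.r = M₀.r)
    (c c' : Status S A) :
    ENNReal.ofReal (likelihood w c.history) * alg.step M₁ c c' =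
      ENNReal.ofReal (likelihood w c'.history) * alg.step M₀ c c' := by
  classical
  cases c with
  | stopped h π =>
    simp only [step, PMF.pure_apply]
    split_ifs with hc
    · rw [hc]
    · simp
  | running h =>
    simp only [step, PMF.bind_apply, ← ENNReal.tsum_mul_left]
    congr 1
    ext d
    rw [mul_left_comm, mul_left_comm _ (alg h d)]
    congr 1
    cases d with
    | output π =>
      simp only [PMF.pure_apply]
      split_ifs with hc
      · rw [hc]; rfl
      · simp
    | query s a =>
      simp only [PMF.map_apply, ← ENNReal.tsum_mul_left]
      congr 1
      ext s'
      rw [hr]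
      split_ifs with hc
      · subst hc
        simp only [Status.history, likelihood, List.map_append, List.prod_append, List.map_cons,
          List.map_nil, List.prod_singleton, MDP.transPMF, PMF.ofFintype_apply, hp]
        have hL := (likelihood_pos hw h).le
        rw [likelihood] at hL
        rw [ENNReal.ofReal_mul hL, ENNReal.ofReal_mul (hw s a s').le, mul_assoc]
      · simp

theorem run_likelihood (alg : Algorithm S A) (hw : ∀ s a s', 0 < w s a s')
    (hp : ∀ s a s', M₁.p s a s' = w s a s' * M₀.p s a s') (hr : M₁.r = M₀.r) (n : ℕ)
    (c : Status S A) :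
    alg.run M₁ n c = ENNReal.ofReal (likelihood w c.history) * alg.run M₀ n c := by
  classical
  induction n generalizing c with
  | zero =>
    simp only [run, PMF.pure_apply]
    split_ifs with hc
    · simp [hc, Status.history, likelihood]
    · simp
  | succ n ih =>
    simp only [run, PMF.bind_apply, ← ENNReal.tsum_mul_left]
    congr 1
    ext c'
    rw [ih, mul_comm (ENNReal.ofReal _), mul_assoc, step_likelihood alg hw hp hr]
    ring

theorem lmean_run_likelihood (alg : Algorithm S A) (hw : ∀ s a s', 0 < w s a s')
    (hp : ∀ s a s', M₁.p s a s' = w s a s' * M₀.p s a s') (hr : M₁.r = M₀.r) (n : ℕ)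
    (g : Status S A → ℝ≥0∞) :
    (lmean (alg.run M₀ n) fun c => ENNReal.ofReal (likelihood w c.history) * g c) =
      lmean (alg.run M₁ n) g := by
  simp only [lmean, run_likelihood alg hw hp hr]
  congr 1
  ext c
  ring

/-- The log-likelihood ratio, compensated by `κ` for each visit to the state where the two models
differ, is a submartingale. -/
theorem le_lmean_log_likelihood [DecidableEq S] (alg : Algorithm S A)
    (hw : ∀ s a s', 0 < w s a s') {κ : ℝ} {s₀ : S}
    (hκ : ∀ s a, 0 ≤ (if s = s₀ then κ else 0) + ∑ s', M₀.p s a s' * Real.log (w s a s'))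
    (b : ℝ) (n : ℕ) :
    ENNReal.ofReal b ≤ lmean (alg.run M₀ n) fun c =>
      ENNReal.ofReal (Real.log (likelihood w c.history) + κ * visits s₀ c.history + b) := by
  have hm := monotone_lmean_run alg M₀ (g := fun c =>
      ENNReal.ofReal (Real.log (likelihood w c.history) + κ * visits s₀ c.history + b))
    (fun h s a => ?_) (fun h π => le_rfl)
  · refine le_trans ?_ (hm (Nat.zero_le n))
    simp [run, lmean_pure, Status.history, likelihood, visits]
  · rw [lmean_transPMF]
    have h1 : ∀ s', Real.log (likelihood w (h ++ [⟨s, a, s', M₀.r s a s'⟩])) =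
        Real.log (likelihood w h) + Real.log (w s a s') := by
      intro s'
      rw [← Real.log_mul (likelihood_pos hw h).ne' (hw s a s').ne']
      simp [likelihood]
    have h2 : ∀ s', (visits s₀ (h ++ [(⟨s, a, s', M₀.r s a s'⟩ : Sample S A)]) : ℝ) =
        visits s₀ h + if s = s₀ then 1 else 0 := by
      intro s'
      simp only [visits, List.countP_append, List.countP_singleton, decide_eq_true_eq]
      push_cast
      rfl
    simp only [Status.history, h1, h2, ← ENNReal.ofReal_mul (M₀.p_nonneg _ _ _)]
    -- Truncation at `0` is subadditive, so the submartingale inequality survives it and no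
    -- integrability question arises.
    refine le_trans (ENNReal.ofReal_le_ofReal ?_) 
      (Finset.le_sum_of_subadditive _ ENNReal.ofReal_zero.le
        (fun _ _ => ENNReal.ofReal_add_le) _ _)
    have h3 : ∑ s', M₀.p s a s' * (Real.log (likelihood w h) + Real.log (w s a s') +
        κ * (visits s₀ h + if s = s₀ then 1 else 0) + b) =
        (∑ s', M₀.p s a s') * (Real.log (likelihood w h) +
          κ * (visits s₀ h + if s = s₀ then 1 else 0) + b) +
        ∑ s', M₀.p s a s' * Real.log (w s a s') := by
      rw [Finset.sum_mul, ← Finset.sum_add_distrib]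
      exact Finset.sum_congr rfl fun s' _ => by ring
    rw [h3, M₀.p_sum]
    have := hκ s a
    split_ifs at this ⊢ <;> linarith

/-- If `E` is output with probability at least `1 - δ` in the model `M₁` and with probability at
most `1/2` in the model `M₀`, then `M₀` needs many samples at the state where the models differ. -/
theorem log_le_mul_expectedVisits [DecidableEq S] (alg : Algorithm S A)
    (hw : ∀ s a s', 0 < w s a s')
    (hp : ∀ s a s', M₁.p s a s' = w s a s' * M₀.p s a s') (hr : M₁.r = M₀.r)
    {κ : ℝ} (hκ0 : 0 ≤ κ) {s₀ : S}
    (hκ : ∀ s a, 0 ≤ (if s = s₀ then κ else 0) + ∑ s', M₀.p s a s' * Real.log (w s a s'))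
    {δ : ℝ} (hδ0 : 0 < δ) (hδ : δ < 1 / 40) {E : Set (Policy A)}
    (h₁ : ENNReal.ofReal (1 - δ) ≤ alg.outputProb M₁ E) (h₀ : alg.outputProb M₀ E ≤ 2⁻¹) :
    ENNReal.ofReal (Real.log (1 / δ) / 10) ≤ ENNReal.ofReal κ * alg.expectedVisits M₀ s₀ := by
  classical
  set Λ : ℝ := Real.log (1 / (2 * δ)) with hΛ
  have hlog2 := Real.log_two_gt_d9
  have hld : 5 * Real.log 2 ≤ Real.log (1 / δ) := by
    rw [show (5 : ℝ) * Real.log 2 = Real.log (2 ^ 5) by rw [Real.log_pow]; norm_num]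
    apply Real.log_le_log (by norm_num)
    rw [le_div_iff₀ hδ0]
    linarith
  have hΛeq : Λ = Real.log (1 / δ) - Real.log 2 := by
    rw [hΛ, ← Real.log_div (by positivity) (by norm_num)]
    congr 1
    field_simp
  have hΛ0 : 0 ≤ Λ := by linarith
  set B : Set (Status S A) := {c | ∃ h, ∃ π ∈ E, c = .stopped h π} with hB
  -- The supremum over rounds need not be attained; giving up `2 * δ` instead of `δ` yields a finite
  -- round.
  obtain ⟨n, hn⟩ : ∃ n, ENNReal.ofReal (1 - 2 * δ) < (alg.run M₁ n).toOuterMeasure B := by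
    apply lt_iSup_iff.1
    refine lt_of_lt_of_le ?_ h₁
    rw [ENNReal.ofReal_lt_ofReal_iff (by linarith)]
    linarith
  have hB0 : (alg.run M₀ n).toOuterMeasure B ≤ 2⁻¹ :=
    (le_iSup (fun n => (alg.run M₀ n).toOuterMeasure B) n).trans h₀
  have hc0 := toOuterMeasure_add_compl (alg.run M₀ n) B
  have hc1 := toOuterMeasure_add_compl (alg.run M₁ n) B
  -- A pointwise form of the data processing inequality: the tangent bound `log z ≤ z - 1` is used
  -- at `z = W` on `B` and at `z = W / (2 * δ)` off `B`. The offset `1 + Λ` makes the inequality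
  -- hold also where the left-hand logarithmic term is truncated to `0`.
  have key : ∀ c : Status S A,
      ENNReal.ofReal (Real.log (likelihood w c.history) + κ * visits s₀ c.history + (1 + Λ)) +
        (1 + ENNReal.ofReal Λ * Bᶜ.indicator 1 c) ≤
      ENNReal.ofReal (likelihood w c.history) *
          (B.indicator 1 c + ENNReal.ofReal (1 / (2 * δ)) * Bᶜ.indicator 1 c) +
        (ENNReal.ofReal κ * visits s₀ c.history + ENNReal.ofReal (1 + Λ)) := by
    intro c
    set W := likelihood w c.history with hWdef
    have hW : 0 < W := likelihood_pos hw _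
    have hN : (0 : ℝ) ≤ visits s₀ c.history := Nat.cast_nonneg _
    have hκN : 0 ≤ κ * (visits s₀ c.history : ℝ) := mul_nonneg hκ0 hN
    have hNN : ENNReal.ofReal κ * (visits s₀ c.history : ℝ≥0∞) =
        ENNReal.ofReal (κ * visits s₀ c.history) := by
      rw [ENNReal.ofReal_mul hκ0, ENNReal.ofReal_natCast]
    rw [hNN, ← ENNReal.ofReal_add hκN (by linarith)]
    by_cases hcB : c ∈ B
    · simp only [Set.indicator_of_mem hcB, Set.indicator_of_notMem (Set.notMem_compl_iff.2 hcB),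
        Pi.one_apply, mul_zero, add_zero, mul_one]
      rw [← ENNReal.ofReal_add hW.le (by linarith), ← ENNReal.ofReal_one]
      rcases le_total 0 (Real.log W + κ * visits s₀ c.history + (1 + Λ)) with h | h
      · rw [← ENNReal.ofReal_add h zero_le_one]
        apply ENNReal.ofReal_le_ofReal
        linarith [Real.log_le_sub_one_of_pos hW]
      · rw [ENNReal.ofReal_of_nonpos h, zero_add]
        apply ENNReal.ofReal_le_ofReal
        linarith
    · simp only [Set.indicator_of_notMem hcB, Set.indicator_of_mem (Set.mem_compl hcB),
        Pi.one_apply, mul_one, zero_add]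
      have hWd : 0 < W * (1 / (2 * δ)) := by positivity
      rw [← ENNReal.ofReal_mul hW.le, ← ENNReal.ofReal_add hWd.le (by linarith),
        ← ENNReal.ofReal_one, ← ENNReal.ofReal_add zero_le_one hΛ0]
      have htan : Real.log W + Λ ≤ W * (1 / (2 * δ)) - 1 := by
        rw [hΛ, ← Real.log_mul hW.ne' (by positivity)]
        exact Real.log_le_sub_one_of_pos hWd
      rcases le_total 0 (Real.log W + κ * visits s₀ c.history + (1 + Λ)) with h | h
      · rw [← ENNReal.ofReal_add h (by linarith)]
        apply ENNReal.ofReal_le_ofReal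
        linarith
      · rw [ENNReal.ofReal_of_nonpos h, zero_add]
        apply ENNReal.ofReal_le_ofReal
        linarith
  have hmean := lmean_mono (alg.run M₀ n) key
  rw [lmean_add, lmean_add, lmean_add, lmean_add, lmean_const, lmean_const,
    lmean_run_likelihood alg hw hp hr, lmean_add, lmean_const_mul, lmean_const_mul,
    lmean_const_mul, ← toOuterMeasure_eq_lmean, ← toOuterMeasure_eq_lmean,
    ← toOuterMeasure_eq_lmean] at hmean
  have hsub := le_lmean_log_likelihood alg hw hκ (1 + Λ) n
  have hvis : (lmean (alg.run M₀ n) fun c => (visits s₀ c.history : ℝ≥0∞)) ≤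
      alg.expectedVisits M₀ s₀ :=
    le_iSup (fun n => lmean (alg.run M₀ n) fun c => (visits s₀ c.history : ℝ≥0∞)) n
  refine le_trans ?_ (mul_le_mul_right hvis _)
  set T : ℝ≥0∞ :=
    ENNReal.ofReal κ * lmean (alg.run M₀ n) fun c => (visits s₀ c.history : ℝ≥0∞)
  set x := (alg.run M₀ n).toOuterMeasure B
  set x' := (alg.run M₀ n).toOuterMeasure Bᶜ
  set y := (alg.run M₁ n).toOuterMeasure B
  set y' := (alg.run M₁ n).toOuterMeasure Bᶜ
  by_cases hT : T = ⊤
  · rw [hT]; exact le_top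
  have hxt : x ≠ ⊤ := fun h => by simp [h] at hc0
  have hxt' : x' ≠ ⊤ := fun h => by simp [h] at hc0
  have hyt : y ≠ ⊤ := fun h => by simp [h] at hc1
  have hyt' : y' ≠ ⊤ := fun h => by simp [h] at hc1
  have hmain : ENNReal.ofReal (1 + Λ) + (1 + ENNReal.ofReal Λ * x') ≤
      y + ENNReal.ofReal (1 / (2 * δ)) * y' + (T + ENNReal.ofReal (1 + Λ)) :=
    le_trans (add_le_add_left hsub _) hmean
  clear_value T x x' y y'
  lift T to NNReal using hT
  lift x to NNReal using hxt
  lift x' to NNReal using hxt'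
  lift y to NNReal using hyt
  lift y' to NNReal using hyt'
  simp only [ENNReal.ofReal] at hmain hn ⊢
  rw [← ENNReal.coe_ofNat, ← ENNReal.coe_inv two_ne_zero] at hB0
  norm_cast at hmain hn hc0 hc1 hB0 ⊢
  rw [← NNReal.coe_le_coe] at hmain hB0
  rw [← NNReal.coe_lt_coe] at hn
  rw [← NNReal.coe_inj] at hc0 hc1
  rw [Real.toNNReal_le_iff_le_coe]
  have hδ2 : 0 ≤ 1 / (2 * δ) := by positivity
  push_cast [Real.coe_toNNReal _ hΛ0, Real.coe_toNNReal (1 + Λ) (by linarith),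
    Real.coe_toNNReal (1 - 2 * δ) (by linarith), Real.coe_toNNReal _ hδ2] at hmain hn hc0 hc1 hB0
  -- What remains is `T ≥ Λ / 2 - 1`, and `log (1 / δ) ≥ 5 * log 2` makes this at least `log (1 / δ)
  -- / 10`.
  have hy' : 1 / (2 * δ) * (y' : ℝ) ≤ 1 := by
    rw [one_div, inv_mul_le_iff₀ (by positivity)]
    linarith
  have hx' : Λ * (1 / 2) ≤ Λ * x' := mul_le_mul_of_nonneg_left (by linarith) hΛ0
  have hy : (0 : ℝ) ≤ y' := y'.2
  linarith

end ChangeOfMeasure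

end Algorithm

/-! ### Values of chain models -/

namespace MDP

variable {S : Type*} [Fintype S] {A : S → Type*} {γ : ℝ}

/-- A solution of the Bellman equation of a policy is its value function. -/
theorem value_eq_of_bellman [DecidableEq S] (M : MDP S A γ) (π : Policy A) (hγ0 : 0 ≤ γ)
    (hγ1 : γ < 1) {v : S → ℝ}
    (hv : ∀ s, v s = M.meanReward π s + γ * ∑ s', M.p s (π s) s' * v s') (s : S) :
    M.value π s = v s := by
  set P := M.chainMatrix π with hP
  have hpow0 : ∀ (t : ℕ) s s', 0 ≤ (P ^ t) s s' := by
    intro t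
    induction t with
    | zero => intro s s'; rw [pow_zero, Matrix.one_apply]; split_ifs <;> norm_num
    | succ t ih =>
      intro s s'
      rw [pow_succ, Matrix.mul_apply]
      exact Finset.sum_nonneg fun x _ => mul_nonneg (ih _ _) (M.p_nonneg _ _ _)
  have hpow1 : ∀ (t : ℕ) s, ∑ s', (P ^ t) s s' = 1 := by
    intro t
    induction t with
    | zero => intro s; simp [Matrix.one_apply]
    | succ t ih =>
      intro s
      simp only [pow_succ, Matrix.mul_apply]
      rw [Finset.sum_comm]
      simp only [← Finset.mul_sum]
      rw [← ih s]
      refine Finset.sum_congr rfl fun x _ => ?_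
      have : ∑ i, P x i = 1 := M.p_sum x (π x)
      rw [this, mul_one]
  obtain ⟨B, hB⟩ : ∃ B : ℝ, ∀ s, |v s| ≤ B := by
    refine ⟨∑ s, |v s|, fun s => ?_⟩
    exact Finset.single_le_sum (f := fun s => |v s|) (fun _ _ => abs_nonneg _) (Finset.mem_univ s)
  set a : ℕ → ℝ := fun t => γ ^ t * ∑ x, (P ^ t) s x * v x with ha
  -- By the Bellman equation the discounted reward at time `t` is a difference of consecutive
  -- discounted expectations of `v`, so the series telescopes to `a 0`.
  have hterm : ∀ t, γ ^ t * ∑ x, (P ^ t) s x * M.meanReward π x = a t - a (t + 1) := by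
    intro t
    have h1 : ∑ x, (P ^ (t + 1)) s x * v x =
        ∑ x, (P ^ t) s x * ∑ s', M.p x (π x) s' * v s' := by
      simp only [pow_succ, Matrix.mul_apply, Finset.sum_mul, Finset.mul_sum]
      rw [Finset.sum_comm]
      simp only [mul_assoc]
      rfl
    have h2 : ∀ x, M.meanReward π x = v x - γ * ∑ s', M.p x (π x) s' * v s' := fun x => by
      linarith [hv x]
    simp only [ha]
    rw [h1]
    simp only [h2, mul_sub, Finset.sum_sub_distrib]
    congr 1
    rw [pow_succ, mul_assoc, Finset.mul_sum _ _ γ]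
    congr 1
    exact Finset.sum_congr rfl fun x _ => by ring
  have habs : ∀ t, |a t| ≤ B * γ ^ t := by
    intro t
    rw [ha]
    simp only
    rw [abs_mul, abs_of_nonneg (pow_nonneg hγ0 t), mul_comm]
    refine mul_le_mul_of_nonneg_right ?_ (pow_nonneg hγ0 t)
    calc |∑ x, (P ^ t) s x * v x| ≤ ∑ x, |(P ^ t) s x * v x| := Finset.abs_sum_le_sum_abs _ _
      _ ≤ ∑ x, (P ^ t) s x * B := by
        refine Finset.sum_le_sum fun x _ => ?_
        rw [abs_mul, abs_of_nonneg (hpow0 t s x)]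
        exact mul_le_mul_of_nonneg_left (hB x) (hpow0 t s x)
      _ = B := by rw [← Finset.sum_mul, hpow1, one_mul]
  have hsum : Summable a :=
    Summable.of_norm_bounded ((summable_geometric_of_lt_one hγ0 hγ1).mul_left B) habs
  have h0 : a 0 = v s := by simp [ha, Matrix.one_apply]
  rw [value, tsum_congr hterm, hsum.tsum_sub ((summable_nat_add_iff 1).2 hsum), hsum.tsum_eq_zero_add,
    h0]
  ring

end MDP

/-! ### Chain models with rescaled rewards -/

/-- The factor by which rewards are scaled, when those earned after the action `l` at `x k` are
scaled by `ρ k l`. -/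
def rewardScale {K L : ℕ} (ρ : Fin K → Fin L → ℝ) : (s : ChainState K L) → ChainAction K L s → ℝ
  | .x k, l => ρ k l
  | .y₁ k l, _ => ρ k l
  | .y₂ _ _, _ => 1

/-- A chain MDP in which the rewards that are earned after the action `l` at `x k` are scaled by
`ρ k l`. -/
def scaledChain {K L : ℕ} (γ : ℝ) (q ρ : Fin K → Fin L → ℝ)
    (hq : ∀ k l, q k l ∈ Set.Ico (0 : ℝ) 1) (hρ : ∀ k l, ρ k l ∈ Set.Icc (0 : ℝ) 1) :
    MDP (ChainState K L) (ChainAction K L) γ where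
  p := chainProb q
  r s a s' := rewardScale ρ s a * chainReward s'
  p_nonneg := (chainMDP γ q hq).p_nonneg
  p_sum := (chainMDP γ q hq).p_sum
  r_mem s a s' := by
    have h : chainReward s' ∈ Set.Icc (0 : ℝ) 1 := (chainMDP γ q hq).r_mem s a s'
    have h' : rewardScale ρ s a ∈ Set.Icc (0 : ℝ) 1 := by
      cases s with
      | x k => exact hρ k a
      | y₁ k l => exact hρ k l
      | y₂ k l => exact ⟨zero_le_one, le_rfl⟩
    exact ⟨mul_nonneg h'.1 h.1, mul_le_one₀ h'.2 h.1 h.2⟩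

section ChainValues

variable {K L : ℕ} {γ : ℝ} {q ρ : Fin K → Fin L → ℝ}

theorem chainMDP_eq_scaledChain (hq : ∀ k l, q k l ∈ Set.Ico (0 : ℝ) 1) :
    chainMDP γ q hq = scaledChain γ q (fun _ _ => 1) hq
      fun _ _ => Set.right_mem_Icc.2 zero_le_one := by
  have h : (fun (s : ChainState K L) (_ : ChainAction K L s) (s' : ChainState K L) => chainReward s') =
      fun s a s' => rewardScale (fun _ _ => 1) s a * chainReward s' := by
    funext s a s'
    cases s <;> exact (one_mul _).symm
  unfold chainMDP scaledChain
  congr 1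

theorem sum_chainProb_x (k : Fin K) (l : Fin L) (f : ChainState K L → ℝ) :
    ∑ s', chainProb q (.x k) l s' * f s' = f (.y₁ k l) := by
  simp [chainProb]

theorem chainProb_y₁_eq (k : Fin K) (l : Fin L) (a) (s' : ChainState K L) :
    chainProb q (.y₁ k l) a s' =
      (if s' = .y₁ k l then q k l else 0) + (if s' = .y₂ k l then 1 - q k l else 0) := by
  cases s' <;> simp [chainProb]

theorem sum_chainProb_y₁ (k : Fin K) (l : Fin L) (a) (f : ChainState K L → ℝ) :
    ∑ s', chainProb q (.y₁ k l) a s' * f s' =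
      q k l * f (.y₁ k l) + (1 - q k l) * f (.y₂ k l) := by
  simp [chainProb_y₁_eq, add_mul, Finset.sum_add_distrib]

theorem sum_chainProb_y₂ (k : Fin K) (l : Fin L) (a) (f : ChainState K L → ℝ) :
    ∑ s', chainProb q (.y₂ k l) a s' * f s' = f (.y₂ k l) := by
  simp [chainProb]

/-- The value function of a policy in a chain model. -/
noncomputable def chainValue {K L : ℕ} (γ : ℝ) (q ρ : Fin K → Fin L → ℝ)
    (π : Policy (ChainAction K L)) : ChainState K L → ℝ
  | .x k => ρ k (π (.x k)) / (1 - γ * q k (π (.x k)))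
  | .y₁ k l => ρ k l * q k l / (1 - γ * q k l)
  | .y₂ _ _ => 0

theorem one_sub_mul_pos (hγ0 : 0 ≤ γ) (hγ1 : γ < 1) {t : ℝ} (ht : t ≤ 1) : 0 < 1 - γ * t := by
  nlinarith

theorem value_scaledChain (hγ0 : 0 ≤ γ) (hγ1 : γ < 1) (hq : ∀ k l, q k l ∈ Set.Ico (0 : ℝ) 1)
    (hρ : ∀ k l, ρ k l ∈ Set.Icc (0 : ℝ) 1) (π : Policy (ChainAction K L))
    (s : ChainState K L) :
    (scaledChain γ q ρ hq hρ).value π s = chainValue γ q ρ π s := by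
  apply MDP.value_eq_of_bellman _ _ hγ0 hγ1
  intro s
  -- The action is a variable because the type of `π s` depends on the state that is split into
  -- cases.
  have key : ∀ a, (chainValue γ q ρ π s =
      ∑ s', chainProb q s a s' * (rewardScale ρ s a * chainReward s') +
        γ * ∑ s', chainProb q s a s' * chainValue γ q ρ π s') ∨ a ≠ π s := by
    intro a
    by_cases ha : a = π s
    swap
    · exact Or.inr ha
    left
    cases s with
    | x k =>
      have h := (one_sub_mul_pos hγ0 hγ1 (hq k a).2.le).ne'
      have h1 := sum_chainProb_x (q := q) k a fun s' => rewardScale ρ (.x k) a * chainReward s'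
      have h2 := sum_chainProb_x (q := q) k a (chainValue γ q ρ π)
      refine Eq.trans ?_ (congrArg₂ (fun u v => u + γ * v) h1 h2).symm
      change ρ k (π (.x k)) / (1 - γ * q k (π (.x k))) =
        ρ k a * 1 + γ * (ρ k a * q k a / (1 - γ * q k a))
      rw [← ha]
      generalize q k a = t at *
      field_simp
      ring
    | y₁ k l =>
      have h := (one_sub_mul_pos hγ0 hγ1 (hq k l).2.le).ne'
      rw [sum_chainProb_y₁, sum_chainProb_y₁]
      simp only [chainValue, chainReward, rewardScale]
      have hV := div_mul_cancel₀ (ρ k l * q k l) h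
      linear_combination hV
    | y₂ k l =>
      rw [sum_chainProb_y₂, sum_chainProb_y₂]
      simp [chainValue, chainReward]
  exact (key (π s)).resolve_right fun h => h rfl

/-- The policy that chooses the action `f k` at `x k`. -/
def chainPolicy (f : Fin K → Fin L) : Policy (ChainAction K L)
  | .x k => f k
  | .y₁ _ _ => ()
  | .y₂ _ _ => ()

theorem le_optValue_scaledChain (hγ0 : 0 ≤ γ) (hγ1 : γ < 1)
    (hq : ∀ k l, q k l ∈ Set.Ico (0 : ℝ) 1) (hρ : ∀ k l, ρ k l ∈ Set.Icc (0 : ℝ) 1)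
    (k : Fin K) (l : Fin L) :
    ρ k l / (1 - γ * q k l) ≤ (scaledChain γ q ρ hq hρ).optValue (.x k) := by
  have hb : BddAbove (Set.range fun π => (scaledChain γ q ρ hq hρ).value π (.x k)) := by
    refine ((Set.finite_range fun l : Fin L => ρ k l / (1 - γ * q k l)).subset ?_).bddAbove
    rintro _ ⟨π, rfl⟩
    exact ⟨π (.x k), (value_scaledChain hγ0 hγ1 hq hρ π (.x k)).symm⟩
  refine le_trans (le_of_eq ?_) (le_ciSup hb (chainPolicy fun _ => l))
  rw [value_scaledChain hγ0 hγ1]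
  rfl

theorem optValue_chainMDP_y₁ [NeZero L] (hγ0 : 0 ≤ γ) (hγ1 : γ < 1)
    (hq : ∀ k l, q k l ∈ Set.Ico (0 : ℝ) 1) (k : Fin K) (l : Fin L) :
    (chainMDP γ q hq).optValue (.y₁ k l) = q k l / (1 - γ * q k l) := by
  have : Nonempty (Policy (ChainAction K L)) := ⟨chainPolicy fun _ => 0⟩
  rw [chainMDP_eq_scaledChain, MDP.optValue]
  simp only [value_scaledChain hγ0 hγ1, chainValue, one_mul, ciSup_const]

theorem optQ_chainMDP_x [NeZero L] (hγ0 : 0 ≤ γ) (hγ1 : γ < 1)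
    (hq : ∀ k l, q k l ∈ Set.Ico (0 : ℝ) 1) (k : Fin K) (l : Fin L) :
    (chainMDP γ q hq).optQ (.x k) l = 1 / (1 - γ * q k l) := by
  have h := (one_sub_mul_pos hγ0 hγ1 (hq k l).2.le).ne'
  refine (sum_chainProb_x (q := q) k l fun s' =>
    chainReward s' + γ * (chainMDP γ q hq).optValue s').trans ?_
  rw [optValue_chainMDP_y₁ hγ0 hγ1]
  simp only [chainReward]
  field_simp
  ring

theorem optValue_chainMDP_x [NeZero L] (hγ0 : 0 ≤ γ) (hγ1 : γ < 1)
    (hq : ∀ k l, q k l ∈ Set.Ico (0 : ℝ) 1) (k : Fin K) {l : Fin L}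
    (hl : ∀ l', q k l' ≤ q k l) :
    (chainMDP γ q hq).optValue (.x k) = 1 / (1 - γ * q k l) := by
  have : Nonempty (Policy (ChainAction K L)) := ⟨chainPolicy fun _ => 0⟩
  rw [chainMDP_eq_scaledChain]
  apply le_antisymm
  · refine ciSup_le fun π => ?_
    rw [value_scaledChain hγ0 hγ1]
    change 1 / (1 - γ * q k (π (.x k))) ≤ _
    apply one_div_le_one_div_of_le (one_sub_mul_pos hγ0 hγ1 (hq k l).2.le)
    have := mul_le_mul_of_nonneg_left (hl (π (.x k))) hγ0
    linarith
  · exact le_optValue_scaledChain (ρ := fun _ _ => 1) hγ0 hγ1 hq _ k l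

/-- If the action `l` at `x k` beats all others by more than `ε`, an `ε`-optimal policy uses it. -/
theorem IsEpsOptimal.action_eq (hγ0 : 0 ≤ γ) (hγ1 : γ < 1)
    (hq : ∀ k l, q k l ∈ Set.Ico (0 : ℝ) 1) (hρ : ∀ k l, ρ k l ∈ Set.Icc (0 : ℝ) 1) {ε : ℝ}
    {k : Fin K} {l : Fin L}
    (hl : ∀ l', l' ≠ l → ρ k l' / (1 - γ * q k l') + ε < ρ k l / (1 - γ * q k l))
    {π : Policy (ChainAction K L)} (hπ : (scaledChain γ q ρ hq hρ).IsEpsOptimal ε π) :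
    π (.x k) = l := by
  by_contra hne
  have h1 := hπ (.x k)
  rw [value_scaledChain hγ0 hγ1] at h1
  have h2 := le_optValue_scaledChain hγ0 hγ1 hq hρ k l
  have h3 := hl _ hne
  simp only [chainValue] at h1
  linarith

/-- A self-loop changed by `d` changes two entries of its row by `d`, which costs `2 * d` in `ℓ¹`;
hence the budget `β / 2`. -/
theorem scaledChain_mem_tvBall {q' : Fin K → Fin L → ℝ} {β : ℝ} (hβ : 0 ≤ β)
    (hq : ∀ k l, q k l ∈ Set.Ico (0 : ℝ) 1) (hq' : ∀ k l, q' k l ∈ Set.Ico (0 : ℝ) 1)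
    (hρ : ∀ k l, ρ k l ∈ Set.Icc (0 : ℝ) 1) (hd : ∀ k l, |q k l - q' k l| ≤ β / 2)
    (hρβ : ∀ k l, 1 - β ≤ ρ k l) :
    scaledChain γ q' ρ hq' hρ ∈ (chainMDP γ q hq).tvBall β := by
  have hr : ∀ (s' : ChainState K L) (k l),
      |chainReward s' - ρ k l * chainReward s'| ≤ β := by
    intro s' k l
    have := hρβ k l
    have := (hρ k l).2
    cases s' <;> simp only [chainReward, mul_zero, mul_one, sub_self, abs_zero, hβ]
    rw [abs_of_nonneg] <;> linarith
  have hp : ∀ (s : ChainState K L) (a : ChainAction K L s),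
      ∑ s', |chainProb q s a s' - chainProb q' s a s'| ≤ β := by
    intro s a
    cases s with
    | x k => simp [chainProb, hβ]
    | y₂ k l => simp [chainProb, hβ]
    | y₁ k l =>
      have h : ∀ s', |chainProb q (.y₁ k l) a s' - chainProb q' (.y₁ k l) a s'| =
          (if s' = .y₁ k l then |q k l - q' k l| else 0) +
            (if s' = .y₂ k l then |q k l - q' k l| else 0) := by
        intro s'
        cases s' with
        | x => simp [chainProb]
        | y₁ k' l' => simp only [chainProb]; split_ifs <;> simp_all
        | y₂ k' l' =>
          simp only [chainProb, reduceCtorEq, if_false, zero_add]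
          split_ifs
          · rw [abs_sub_comm (q k l)]; congr 1; ring
          · simp
      simp only [h, Finset.sum_add_distrib, Finset.sum_ite_eq', Finset.mem_univ, if_true]
      linarith [hd k l]
  have hr' : ∀ (s : ChainState K L) (a : ChainAction K L s) (s' : ChainState K L),
      |chainReward s' - rewardScale ρ s a * chainReward s'| ≤ β := by
    intro s a s'
    cases s with
    | x k => exact hr s' k a
    | y₁ k l => exact hr s' k l
    | y₂ k l => simp [rewardScale, hβ]
  rw [MDP.tvBall, Set.mem_ofPred_eq, MDP.tvDist]
  apply max_le
  · exact Real.iSup_le (fun x => hp x.1 x.2) hβ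
  · exact Real.iSup_le (fun x => hr' x.1.1 x.1.2 x.2) hβ

end ChainValues

/-! ### The common level of the near-optimal actions -/

/-- The levels `u` and increments `η` that serve at a state whose best self-loop probability is
`t`: every near-optimal action can be moved to the level `u` and then be raised by `η`. -/
structure IsLevel (β γ ε t u η : ℝ) : Prop where
  incr_pos : 0 < η
  incr_le : η ≤ β / 2
  level_ge : 1 / 100 ≤ u
  -- Bounds the relative entropy of a raise: the raised probability is at least `1 / 100`, which the
  -- factor `100` absorbs, so only its complement appears.
  incr_sq_le : 100 * η ^ 2 ≤
    10 ^ 7 * (ε ^ 2 * (1 - γ) ^ 3) * (1 - max u (t - β / 2) - η)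
  gap : ε * (1 - γ * u) ^ 2 < γ * η
  -- The reward factor that ties the best action to the level is at least `1 - β`.
  scale : (1 - β) * (1 - γ * u) ≤ 1 - γ * max u (t - β / 2)
  reach_best : u + η ≤ t + β / 2
  reach : ∀ x, 0 ≤ x → x < 1 → 1 / (1 - γ * t) - 1 / (1 - γ * x) <
    lowerGap β γ ε (1 / (1 - γ * t)) → u + η ≤ x + β / 2

/-- Here every self-loop can be lowered to `u = (4 * γ - 1) / (3 * γ)`, so no reward scaling is
needed. This level has `1 - γ * u = 4 / 3 * (1 - γ)`, and `γ * η` is four times `ε * (1 - γ * u) ^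
2`. -/
theorem exists_isLevel_of_one_le {β γ ε t : ℝ} (hβ0 : 0 < β) (hβ2 : β < 2) (hγ : 0.4 < γ)
    (hγ1 : γ < 1) (ht1 : t < 1) (ht : (4 * γ - 1) / (3 * γ) < t) (hε : 0 < ε)
    (hε' : ε < β * γ * (1 / (1 - γ * t)) ^ 2 / 16 * ((1 - γ) / (3 * γ)))
    (hcase : 1 ≤ β / 2 + (4 * γ - 1) / (3 * γ)) : ∃ u η, IsLevel β γ ε t u η := by
  have hγ0 : 0 < γ := by linarith
  obtain ⟨u, hu⟩ : ∃ u, u = (4 * γ - 1) / (3 * γ) := ⟨_, rfl⟩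
  have hγu : γ * u = (4 * γ - 1) / 3 := by rw [hu]; field_simp
  have hb : 0 < 1 - γ := by linarith
  have hab : 1 - γ < 1 - γ * t := by nlinarith
  have hεb : ε * (1 - γ) ^ 2 < β * (1 - γ) / 48 := by
    calc ε * (1 - γ) ^ 2 ≤ ε * (1 - γ * t) ^ 2 := by gcongr
      _ < β * γ * (1 / (1 - γ * t)) ^ 2 / 16 * ((1 - γ) / (3 * γ)) * (1 - γ * t) ^ 2 := by
        gcongr; nlinarith
      _ = β * (1 - γ) / 48 := by
        have : 1 - γ * t ≠ 0 := by linarith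
        generalize 1 - γ * t = a at *
        field_simp
        ring
  obtain ⟨η, hη⟩ : ∃ η, γ * η = 64 / 9 * (ε * (1 - γ) ^ 2) :=
    ⟨64 / 9 * (ε * (1 - γ) ^ 2) / γ, by field_simp⟩
  have hη0 : 0 < η := by
    refine pos_of_mul_pos_right (a := γ) ?_ hγ0.le
    rw [hη]; positivity
  have hηβ : γ * η < 4 / 27 * (β * (1 - γ)) := by linarith
  have hβb : β * (1 - γ) < 2 * (1 - γ) := by gcongr
  have hηle : η ≤ β / 2 := by
    have : γ * η ≤ γ * (β / 2) := by nlinarith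
    exact le_of_mul_le_mul_left this hγ0
  rw [← hu] at ht hcase
  have hmax : max u (t - β / 2) = u := max_eq_left (by linarith)
  have hhalf : 1 / 2 ≤ u := by
    refine le_of_mul_le_mul_left ?_ hγ0
    rw [hγu]; linarith
  refine ⟨u, η, hη0, hηle, by linarith, ?_, ?_, ?_, by linarith, ?_⟩
  · rw [hmax]
    have h1 : (1 - γ) / 27 ≤ γ * (1 - u - η) := by nlinarith
    have h2 : γ ^ 2 * (100 * η ^ 2) ≤
        γ ^ 2 * (10 ^ 7 * (ε ^ 2 * (1 - γ) ^ 3) * (1 - u - η)) := by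
      calc γ ^ 2 * (100 * η ^ 2) = 100 * (γ * η) ^ 2 := by ring
        _ = 100 * (64 / 9) ^ 2 * (ε ^ 2 * (1 - γ) ^ 4) := by rw [hη]; ring
        _ ≤ 10 ^ 7 * 0.4 / 27 * (ε ^ 2 * (1 - γ) ^ 4) := by gcongr; norm_num
        _ = 10 ^ 7 * (ε ^ 2 * (1 - γ) ^ 3) * (0.4 * ((1 - γ) / 27)) := by ring
        _ ≤ 10 ^ 7 * (ε ^ 2 * (1 - γ) ^ 3) * (γ * (γ * (1 - u - η))) := by gcongr
        _ = _ := by ring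
    exact le_of_mul_le_mul_left h2 (by positivity)
  · rw [hγu, hη]
    have : 0 < ε * (1 - γ) ^ 2 := by positivity
    linarith
  · rw [hmax, hγu]
    nlinarith
  · intro x hx0 hx1 hx
    rw [lowerGap, if_pos (hu ▸ hcase)] at hx
    -- The denominator in `lowerGap` encodes the self-loop probability `u + η - β / 2`, the least
    -- from which `u + η` is within reach.
    have hD : 12 * (1 - γ) - 64 * (1 - γ) ^ 2 * ε + 4.5 * β * γ =
        9 * (1 - γ * (u + η) + γ * (β / 2)) := by
      linear_combination 9 * hγu + 9 * hη
    rw [hD] at hx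
    have hD0 : 0 < 1 - γ * (u + η) + γ * (β / 2) := by
      have : 0 < γ * β := by positivity
      nlinarith
    have hx' : 0 < 1 - γ * x := one_sub_mul_pos hγ0.le hγ1 hx1.le
    have h1 : 9 / (9 * (1 - γ * (u + η) + γ * (β / 2))) =
        1 / (1 - γ * (u + η) + γ * (β / 2)) := by
      rw [div_eq_div_iff (by positivity) hD0.ne']; ring
    rw [h1] at hx
    have h2 : 1 / (1 - γ * (u + η) + γ * (β / 2)) < 1 / (1 - γ * x) := by linarith
    rw [one_div_lt_one_div hD0 hx'] at h2
    have h3 : γ * (u + η) < γ * (x + β / 2) := by linarith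
    exact (lt_of_mul_lt_mul_left h3 hγ0.le).le

/-- The best self-loop can be lowered only to `ℓ = t - β / 2`, where `1 - γ * ℓ = A`. The level lies
`2 * η` below `ℓ`, with `γ * η = 4 * ε * A ^ 2`, and scaled rewards bridge the difference. The floor
`1 / 100` keeps the self-loops away from `0`. -/
theorem exists_isLevel_of_lt_one {β γ ε t : ℝ} (hβ0 : 0 < β) (hγ : 0.4 < γ)
    (hβγ : 1 - 10 * β < γ) (hγ1 : γ < 1) (ht1 : t < 1) (ht : (4 * γ - 1) / (3 * γ) < t)
    (hε : 0 < ε) (hε' : ε < β * γ * (1 / (1 - γ * t)) ^ 2 / 16 * (β / 2))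
    (hcase : β / 2 + (4 * γ - 1) / (3 * γ) < 1) : ∃ u η, IsLevel β γ ε t u η := by
  have hγ0 : 0 < γ := by linarith
  have hb : 0 < 1 - γ := by linarith
  obtain ⟨p, hp⟩ : ∃ p, p = (4 * γ - 1) / (3 * γ) := ⟨_, rfl⟩
  have hγp : γ * p = (4 * γ - 1) / 3 := by rw [hp]; field_simp
  rw [← hp] at ht
  have hcase' := hcase
  rw [← hp] at hcase
  obtain ⟨a, ha⟩ : ∃ a, a = 1 - γ * t := ⟨_, rfl⟩
  have hab : 1 - γ < a := by rw [ha]; nlinarith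
  have ha0 : 0 < a := by linarith
  have hab' : a ≤ 4 / 3 * (1 - γ) := by rw [ha]; nlinarith
  have hd : γ * β / 2 < (1 - γ) / 3 := by nlinarith
  -- `β ≥ 1` would give `γ / 2 < (1 - γ) / 3`, that is `γ < 0.4`.
  have hβ1 : β < 1 := by
    by_contra! h
    nlinarith
  obtain ⟨A, hA⟩ : ∃ A, A = a + γ * β / 2 := ⟨_, rfl⟩
  have hA0 : 0 < A := by rw [hA]; positivity
  have haA : A ≤ 4 / 3 * a := by linarith
  have hAb : A ≤ 5 / 3 * (1 - γ) := by linarith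
  have hεa : ε * a ^ 2 < γ * β ^ 2 / 32 := by
    rw [← ha] at hε'
    calc ε * a ^ 2 < β * γ * (1 / a) ^ 2 / 16 * (β / 2) * a ^ 2 := by gcongr
      _ = _ := by field_simp; ring
  have hA2 : A ^ 2 ≤ 16 / 9 * a ^ 2 := by
    calc A ^ 2 ≤ (4 / 3 * a) ^ 2 := by gcongr
      _ = _ := by ring
  have hεA : ε * A ^ 2 < γ * β ^ 2 / 18 := by
    calc ε * A ^ 2 ≤ ε * (16 / 9 * a ^ 2) := by gcongr
      _ = 16 / 9 * (ε * a ^ 2) := by ring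
      _ < 16 / 9 * (γ * β ^ 2 / 32) := by gcongr
      _ = _ := by ring
  obtain ⟨η, hη⟩ : ∃ η, γ * η = 4 * (ε * A ^ 2) :=
    ⟨4 * (ε * A ^ 2) / γ, by field_simp⟩
  have hη0 : 0 < η := by
    refine pos_of_mul_pos_right (a := γ) ?_ hγ0.le
    rw [hη]; positivity
  have hηβ : η < 2 / 9 * β ^ 2 := by
    refine lt_of_mul_lt_mul_left (a := γ) ?_ hγ0.le
    rw [hη]; linarith
  have hβsq : β ^ 2 ≤ β := by nlinarith
  have hεA1 : 8 * (ε * A) ≤ 2 / 9 * β := by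
    have h1 : 8 * (ε * A) * A < 2 / 9 * β * A := by
      have h2 : γ * β * (2 * β) ≤ A * β := by
        have := mul_le_mul_of_nonneg_right (by linarith : γ * β * 2 ≤ A) hβ0.le
        linarith
      linarith
    exact (lt_of_mul_lt_mul_right h1 hA0.le).le
  obtain ⟨ℓ, hℓ⟩ : ∃ ℓ, ℓ = t - β / 2 := ⟨_, rfl⟩
  have hγℓ : γ * ℓ = 1 - A := by rw [hℓ, hA, ha]; ring
  obtain ⟨u, hu⟩ : ∃ u, u = max (ℓ - 2 * η) (1 / 100) := ⟨_, rfl⟩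
  have hu1 : ℓ - 2 * η ≤ u := hu ▸ le_max_left _ _
  have hu2 : 1 / 100 ≤ u := hu ▸ le_max_right _ _
  have hγu : γ * (ℓ - 2 * η) ≤ γ * u := mul_le_mul_of_nonneg_left hu1 hγ0.le
  have hsmall : ∀ x, 0 ≤ x → ℓ - η ≤ x + β / 2 → u + η ≤ x + β / 2 := by
    intro x hx hxl
    rw [← le_sub_iff_add_le, hu]
    refine max_le (by linarith) ?_
    -- The floor `1 / 100` must be reachable too. For `γ ≥ 1/2` the best self-loop exceeds `2 / 3`,
    -- which forces `x` to be large enough; for `γ ≤ 1/2`, `1 - 10 * β < γ` gives `β > 1 / 20`, and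
    -- the budget alone suffices.
    rcases le_total 0.5 γ with h | h
    · have hp2 : p ≥ 2 / 3 := by
        refine le_of_mul_le_mul_left (a := γ) ?_ hγ0
        rw [hγp]; linarith
      have hβ3 : β ^ 2 ≤ (2 / 3) ^ 2 := by gcongr; linarith
      linarith
    · linarith
  have hmax : 5 / 18 * β ≤ 1 - max u ℓ - η := by
    have h1 : max u ℓ ≤ max ℓ (1 / 100) := by
      rw [hu]
      refine max_le (max_le (le_max_of_le_left (by linarith)) (le_max_right _ _))
        (le_max_left _ _)
    have h2 : max ℓ (1 / 100) ≤ 1 - 1 / 2 * β := by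
      refine max_le (by linarith) (by linarith)
    linarith
  have hγ1u : 1 - γ * u ≤ A + 2 * (γ * η) := by linarith
  refine ⟨u, η, hη0, by linarith, hu2, ?_, ?_, ?_, ?_, ?_⟩
  · rw [← hℓ]
    -- Since `1 - γ < 10 * β`, this follows from the bound `5 / 18 * β` in `hmax`.
    have h1 : (1 - γ) / 36 ≤ 1 - max u ℓ - η := by linarith
    have hA4 : A ^ 4 ≤ (5 / 3 * (1 - γ)) ^ 4 := by gcongr
    have h2 : γ ^ 2 * (100 * η ^ 2) ≤
        γ ^ 2 * (10 ^ 7 * (ε ^ 2 * (1 - γ) ^ 3) * (1 - max u ℓ - η)) := by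
      calc γ ^ 2 * (100 * η ^ 2) = 100 * (γ * η) ^ 2 := by ring
        _ = 1600 * (ε ^ 2 * A ^ 4) := by rw [hη]; ring
        _ ≤ 1600 * (ε ^ 2 * (5 / 3 * (1 - γ)) ^ 4) := by gcongr
        _ = 1600 * (5 / 3) ^ 4 * (ε ^ 2 * (1 - γ) ^ 4) := by ring
        _ ≤ 0.4 ^ 2 * 10 ^ 7 / 36 * (ε ^ 2 * (1 - γ) ^ 4) := by gcongr; norm_num
        _ = 0.4 ^ 2 * (10 ^ 7 * (ε ^ 2 * (1 - γ) ^ 3) * ((1 - γ) / 36)) := by ring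
        _ ≤ γ ^ 2 * (10 ^ 7 * (ε ^ 2 * (1 - γ) ^ 3) * (1 - max u ℓ - η)) := by gcongr
    exact le_of_mul_le_mul_left h2 (by positivity)
  · have hu1' : 0 < 1 - γ * u :=
      one_sub_mul_pos hγ0.le hγ1 (by linarith [le_max_left u ℓ])
    have h1 : 1 - γ * u < 2 * A := by
      have : 8 * (ε * A) * A < 1 * A := by gcongr; linarith
      linarith
    calc ε * (1 - γ * u) ^ 2 < ε * (2 * A) ^ 2 := by gcongr
      _ = γ * η := by rw [hη]; ring
  · rw [← hℓ]
    rcases le_total ℓ u with h | h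
    · rw [max_eq_left h]
      have : 0 < 1 - γ * u :=
        one_sub_mul_pos hγ0.le hγ1 (by linarith [le_max_left u ℓ])
      have h3 : 0 ≤ β * (1 - γ * u) := by positivity
      linarith
    · rw [max_eq_right h, hγℓ]
      -- Thus `1 - γ * u ≤ (1 + 2 / 9 * β) * A`, and `(1 - β) * (1 + 2 / 9 * β) ≤ 1`.
      have : 8 * (ε * A) * A ≤ 2 / 9 * β * A := by gcongr
      have h3 : (1 - β) * (1 - γ * u) ≤ (1 - β) * (A + 2 * (γ * η)) := by
        apply mul_le_mul_of_nonneg_left hγ1u; linarith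
      have h4 : 0 ≤ β * (2 * (γ * η)) := by positivity
      have h5 : 0 ≤ β * A := by positivity
      linarith
  · apply hsmall
    · have : 0 < p := by
        refine pos_of_mul_pos_right (a := γ) ?_ hγ0.le
        rw [hγp]; linarith
      linarith
    · linarith
  · intro x hx0 hx1 hx
    apply hsmall x hx0
    rw [lowerGap, if_neg (not_le.2 hcase'), ← ha] at hx
    have hx' : 0 < 1 - γ * x := one_sub_mul_pos hγ0.le hγ1 hx1.le
    have hD0 : 0 < a + γ * β + 4 * (ε * A ^ 2) := by positivity
    have h1 : (1 / a) ^ 2 / (1 / a + β * γ * (1 / a) ^ 2 +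
        4 * ε * (1 + γ * β * (1 / a) / 2) ^ 2) = 1 / (a + γ * β + 4 * (ε * A ^ 2)) := by
      rw [hA] at hD0 ⊢
      have h2 : 1 / a + β * γ * (1 / a) ^ 2 + 4 * ε * (1 + γ * β * (1 / a) / 2) ^ 2 =
          (a + γ * β + 4 * (ε * (a + γ * β / 2) ^ 2)) * (1 / a) ^ 2 := by
        field_simp
      rw [h2, div_eq_div_iff (by positivity) hD0.ne']
      ring
    rw [h1] at hx
    have h2 : 1 / (a + γ * β + 4 * (ε * A ^ 2)) < 1 / (1 - γ * x) := by linarith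
    rw [one_div_lt_one_div hD0 hx'] at h2
    have h3 : γ * (ℓ - η) ≤ γ * (x + β / 2) := by linarith
    exact le_of_mul_le_mul_left h3 hγ0

theorem exists_isLevel {β γ ε t : ℝ} (hβ0 : 0 < β) (hβ2 : β < 2) (hγ : max 0.4 (1 - 10 * β) < γ)
    (hγ1 : γ < 1) (ht1 : t < 1) (ht : (4 * γ - 1) / (3 * γ) < t) (hε : 0 < ε)
    (hε' : ε < β * γ * (1 / (1 - γ * t)) ^ 2 / 16 * min (β / 2) ((1 - γ) / (3 * γ))) :
    ∃ u η, IsLevel β γ ε t u η := by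
  obtain ⟨hγ4, hβγ⟩ := max_lt_iff.1 hγ
  have hγ0 : 0 < γ := by linarith
  have hpos : 0 ≤ β * γ * (1 / (1 - γ * t)) ^ 2 / 16 := by positivity
  rcases le_or_gt 1 (β / 2 + (4 * γ - 1) / (3 * γ)) with h | h
  · exact exists_isLevel_of_one_le hβ0 hβ2 hγ4 hγ1 ht1 ht hε
      (hε'.trans_le (mul_le_mul_of_nonneg_left (min_le_right _ _) hpos)) h
  · exact exists_isLevel_of_lt_one hβ0 hγ4 hβγ hγ1 ht1 ht hε
      (hε'.trans_le (mul_le_mul_of_nonneg_left (min_le_left _ _) hpos)) h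

/-! ### Moving actions to the level and raising one of them -/

/-- The self-loop probability `x` moved to the level `u`, or as close as a change by `β / 2`
allows, if that level can be reached. -/
noncomputable def levelProb (β u η x : ℝ) : ℝ :=
  if u + η ≤ x + β / 2 then max u (x - β / 2) else x

/-- The reward factor that equates the value to that of the level `u`, if that level can be
reached. -/
noncomputable def levelScale (γ β u η x : ℝ) : ℝ :=
  if u + η ≤ x + β / 2 then (1 - γ * max u (x - β / 2)) / (1 - γ * u) else 1

namespace IsLevel

variable {β γ ε t u η x : ℝ}

theorem max_add_lt_one (h : IsLevel β γ ε t u η) (hγ1 : γ < 1) :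
    max u (t - β / 2) + η < 1 := by
  have h1 := h.incr_pos
  have h2 := h.incr_sq_le
  have hb : 0 < 1 - γ := by linarith
  by_contra! h3
  have : 10 ^ 7 * (ε ^ 2 * (1 - γ) ^ 3) * (1 - max u (t - β / 2) - η) ≤ 0 :=
    mul_nonpos_of_nonneg_of_nonpos (by positivity) (by linarith)
  have : 0 < 100 * η ^ 2 := by positivity
  linarith

theorem max_le_max (hxt : x ≤ t) : max u (x - β / 2) ≤ max u (t - β / 2) := by
  gcongr

theorem level_lt_one (h : IsLevel β γ ε t u η) (hγ1 : γ < 1) : u < 1 := by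
  linarith [h.max_add_lt_one hγ1, le_max_left u (t - β / 2), h.incr_pos]

theorem levelProb_mem (h : IsLevel β γ ε t u η) (hγ1 : γ < 1) (hx : x ∈ Set.Ico (0 : ℝ) 1)
    (hxt : x ≤ t) : levelProb β u η x ∈ Set.Ico (0 : ℝ) 1 := by
  rw [levelProb]
  split_ifs
  · have := h.level_ge
    exact ⟨le_max_of_le_left (by linarith), by
      linarith [h.max_add_lt_one hγ1, max_le_max (u := u) (β := β) hxt, h.incr_pos]⟩
  · exact hx

theorem abs_sub_levelProb_le (h : IsLevel β γ ε t u η) : |x - levelProb β u η x| ≤ β / 2 := by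
  have h1 := h.incr_pos
  have h2 := h.incr_le
  rw [levelProb]
  split_ifs with hr
  · rw [abs_le]
    have h3 := le_max_right u (x - β / 2)
    have h4 : max u (x - β / 2) ≤ x + β / 2 := max_le (by linarith) (by linarith)
    constructor <;> linarith
  · rw [sub_self, abs_zero]; linarith

theorem levelScale_le_one (h : IsLevel β γ ε t u η) (hγ0 : 0 ≤ γ) (hγ1 : γ < 1) :
    levelScale γ β u η x ≤ 1 := by
  rw [levelScale]
  split_ifs with hr
  · rw [div_le_one (one_sub_mul_pos hγ0 hγ1 (h.level_lt_one hγ1).le)]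
    have := mul_le_mul_of_nonneg_left (le_max_left u (x - β / 2)) hγ0
    linarith
  · exact le_rfl

theorem levelScale_nonneg (h : IsLevel β γ ε t u η) (hγ0 : 0 ≤ γ) (hγ1 : γ < 1) (hxt : x ≤ t) :
    0 ≤ levelScale γ β u η x := by
  rw [levelScale]
  split_ifs with hr
  · refine div_nonneg (one_sub_mul_pos hγ0 hγ1 ?_).le
      (one_sub_mul_pos hγ0 hγ1 (h.level_lt_one hγ1).le).le
    linarith [h.max_add_lt_one hγ1, max_le_max (u := u) (β := β) hxt, h.incr_pos]
  · exact zero_le_one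

theorem one_sub_le_levelScale (h : IsLevel β γ ε t u η) (hγ0 : 0 ≤ γ) (hγ1 : γ < 1)
    (hβ : 0 ≤ β) (hxt : x ≤ t) : 1 - β ≤ levelScale γ β u η x := by
  rw [levelScale]
  split_ifs with hr
  · rw [le_div_iff₀ (one_sub_mul_pos hγ0 hγ1 (h.level_lt_one hγ1).le)]
    have := mul_le_mul_of_nonneg_left (max_le_max (u := u) (β := β) hxt) hγ0
    linarith [h.scale]
  · linarith

/-- A reachable action has exactly the value of the level. An unreachable one is left alone, and `η
≤ β / 2` shows that its self-loop is already below `u`. -/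
theorem levelValue_le (h : IsLevel β γ ε t u η) (hγ0 : 0 ≤ γ) (hγ1 : γ < 1) (hxt : x ≤ t) :
    levelScale γ β u η x / (1 - γ * levelProb β u η x) ≤ 1 / (1 - γ * u) := by
  have hu := one_sub_mul_pos hγ0 hγ1 (h.level_lt_one hγ1).le
  rw [levelScale, levelProb]
  split_ifs with hr
  · have : 0 < 1 - γ * max u (x - β / 2) := by
      refine one_sub_mul_pos hγ0 hγ1 ?_
      linarith [h.max_add_lt_one hγ1, max_le_max (u := u) (β := β) hxt, h.incr_pos]
    rw [div_right_comm, div_self this.ne']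
  · apply one_div_le_one_div_of_le hu
    have := h.incr_le
    have : γ * x ≤ γ * u := mul_le_mul_of_nonneg_left (by linarith) hγ0
    linarith

theorem levelProb_pos (h : IsLevel β γ ε t u η) (hr : u + η ≤ x + β / 2) :
    0 < levelProb β u η x := by
  rw [levelProb, if_pos hr]
  exact lt_of_lt_of_le (by linarith [h.level_ge]) (le_max_left _ _)

theorem levelProb_add_lt_one (h : IsLevel β γ ε t u η) (hγ1 : γ < 1) (hxt : x ≤ t)
    (hr : u + η ≤ x + β / 2) : levelProb β u η x + η < 1 := by
  rw [levelProb, if_pos hr]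
  linarith [h.max_add_lt_one hγ1, max_le_max (u := u) (β := β) hxt]

theorem abs_sub_levelProb_add_le (h : IsLevel β γ ε t u η) (hr : u + η ≤ x + β / 2) :
    |x - (levelProb β u η x + η)| ≤ β / 2 := by
  rw [levelProb, if_pos hr, abs_le]
  have h1 := h.incr_pos
  have h2 := h.incr_le
  have h3 := le_max_right u (x - β / 2)
  have h4 : max u (x - β / 2) ≤ x + β / 2 - η := max_le (by linarith) (by linarith)
  constructor <;> linarith

/-- With `m` the moved self-loop, the raise gains `γ * η / ((1 - γ * u) * (1 - γ * (m + η)))`, which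
is at least `γ * η / (1 - γ * u) ^ 2` because `u ≤ m`; the field `gap` makes this exceed `ε`. -/
theorem lt_raisedValue (h : IsLevel β γ ε t u η) (hγ0 : 0 < γ) (hγ1 : γ < 1) (hε : 0 < ε)
    (hxt : x ≤ t) (hr : u + η ≤ x + β / 2) :
    1 / (1 - γ * u) + ε < levelScale γ β u η x / (1 - γ * (levelProb β u η x + η)) := by
  have hc := one_sub_mul_pos hγ0.le hγ1 (h.level_lt_one hγ1).le
  have ha := one_sub_mul_pos hγ0.le hγ1 (h.levelProb_add_lt_one hγ1 hxt hr).le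
  have hg : 0 < γ * η := mul_pos hγ0 h.incr_pos
  have hgap := h.gap
  have hle : 1 - γ * max u (x - β / 2) ≤ 1 - γ * u := by
    have := mul_le_mul_of_nonneg_left (le_max_left u (x - β / 2)) hγ0.le
    linarith
  rw [levelScale, levelProb, if_pos hr, if_pos hr] at *
  rw [lt_div_iff₀ ha, lt_div_iff₀ hc]
  generalize max u (x - β / 2) = m at *
  have h1 : (1 / (1 - γ * u) + ε) * (1 - γ * (m + η)) * (1 - γ * u) =
      (1 - γ * (m + η)) + ε * (1 - γ * u) * (1 - γ * (m + η)) := by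
    generalize 1 - γ * (m + η) = a
    generalize 1 - γ * u = c at *
    field_simp
  have h2 : ε * (1 - γ * u) * (1 - γ * (m + η)) ≤ ε * (1 - γ * u) * (1 - γ * u) :=
    mul_le_mul_of_nonneg_left (by linarith) (by positivity)
  rw [h1]
  linarith

theorem incr_sq_le_mul (h : IsLevel β γ ε t u η) (hγ1 : γ < 1)
    (hxt : x ≤ t) (hr : u + η ≤ x + β / 2) :
    η ^ 2 ≤ 10 ^ 7 * (ε ^ 2 * (1 - γ) ^ 3) *
      ((levelProb β u η x + η) * (1 - (levelProb β u η x + η))) := by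
  have hb : 0 < 1 - γ := by linarith
  have h1 := h.levelProb_add_lt_one hγ1 hxt hr
  rw [levelProb, if_pos hr] at *
  have h2 := max_le_max (u := u) (β := β) hxt
  have h3 : 1 / 100 ≤ max u (x - β / 2) + η := by
    linarith [le_max_left u (x - β / 2), h.level_ge, h.incr_pos]
  have h4 : 10 ^ 7 * (ε ^ 2 * (1 - γ) ^ 3) * (1 - max u (t - β / 2) - η) ≤
      10 ^ 7 * (ε ^ 2 * (1 - γ) ^ 3) * (1 - (max u (x - β / 2) + η)) := by
    apply mul_le_mul_of_nonneg_left _ (by positivity)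
    linarith
  have h5 : 0 ≤ 10 ^ 7 * (ε ^ 2 * (1 - γ) ^ 3) * (1 - (max u (x - β / 2) + η)) :=
    mul_nonneg (by positivity) (by linarith)
  have h6 := mul_le_mul_of_nonneg_right h3 h5
  linarith [h.incr_sq_le]

end IsLevel

/-! ### Relative entropy and likelihood ratio of a raise -/

/-- A bound of the relative entropy of two Bernoulli distributions. -/
theorem neg_le_bernoulli_log {p η κ : ℝ} (hp : 0 < p) (hη : 0 < η) (hpη : p + η < 1)
    (hκ : η ^ 2 ≤ κ * ((p + η) * (1 - (p + η)))) :
    0 ≤ κ + (p * Real.log ((p + η) / p) +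
      (1 - p) * Real.log ((1 - (p + η)) / (1 - p))) := by
  have h1 : 0 < 1 - (p + η) := by linarith
  have h2 : 0 < 1 - p := by linarith
  have h3 : 0 < p + η := by linarith
  -- `log z ≥ 1 - 1 / z` bounds the relative entropy by the chi-square divergence, which is `η ^ 2 /
  -- ((p + η) * (1 - (p + η)))`.
  have l1 := mul_le_mul_of_nonneg_left
    (Real.one_sub_inv_le_log_of_pos (div_pos h3 hp)) hp.le
  have l2 := mul_le_mul_of_nonneg_left
    (Real.one_sub_inv_le_log_of_pos (div_pos h1 h2)) h2.le
  have h4 : η ^ 2 / ((p + η) * (1 - (p + η))) ≤ κ := by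
    rwa [div_le_iff₀ (by positivity)]
  have h5 : p * (1 - ((p + η) / p)⁻¹) + (1 - p) * (1 - ((1 - (p + η)) / (1 - p))⁻¹) =
      -(η ^ 2 / ((p + η) * (1 - (p + η)))) := by
    rw [inv_div, inv_div]
    obtain ⟨b, hb⟩ : ∃ b, b = 1 - (p + η) := ⟨_, rfl⟩
    obtain ⟨d, hd⟩ : ∃ d, d = p + η := ⟨_, rfl⟩
    rw [← hb, ← hd]
    rw [← hd] at h3
    rw [← hb] at h1
    field_simp
    rw [hb, hd]
    ring
  linarith

section Chain

variable {K L : ℕ} {γ : ℝ}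

/-- The self-loop probabilities `q` with the one of `y₁ k l` raised by `η`. -/
def raise (q : Fin K → Fin L → ℝ) (k : Fin K) (l : Fin L) (η : ℝ) (k' : Fin K) (l' : Fin L) : ℝ :=
  if k' = k ∧ l' = l then q k l + η else q k' l'

/-- The likelihood ratio of the transitions when the self-loop probability of `y₁ k l` is raised
from `p` to `p + η`. -/
noncomputable def raiseRatio (k : Fin K) (l : Fin L) (p η : ℝ) (s : ChainState K L)
    (_ : ChainAction K L s) (s' : ChainState K L) : ℝ :=
  if s = .y₁ k l then
    if s' = .y₁ k l then (p + η) / p else if s' = .y₂ k l then (1 - (p + η)) / (1 - p) else 1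
  else 1

theorem raiseRatio_pos (k : Fin K) (l : Fin L) {p η : ℝ} (hp : 0 < p) (hη : 0 < η)
    (hpη : p + η < 1) (s a s') : 0 < raiseRatio k l p η s a s' := by
  have h1 : 0 < 1 - (p + η) := by linarith
  have h2 : 0 < 1 - p := by linarith
  rw [raiseRatio]
  split_ifs <;> positivity

theorem chainProb_raise (q : Fin K → Fin L → ℝ) (k : Fin K) (l : Fin L) {η : ℝ}
    (hp : 0 < q k l) (hp1 : q k l < 1) (s a s') :
    chainProb (raise q k l η) s a s' = raiseRatio k l (q k l) η s a s' * chainProb q s a s' := by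
  have h1 : 1 - q k l ≠ 0 := by linarith
  cases s with
  | x k' => simp [raiseRatio, chainProb]
  | y₂ k' l' => simp [raiseRatio, chainProb]
  | y₁ k' l' =>
    by_cases h : k' = k ∧ l' = l
    · obtain ⟨rfl, rfl⟩ := h
      simp only [raiseRatio, chainProb, raise, and_self, if_true]
      split_ifs
      · rw [div_mul_cancel₀ _ hp.ne']
      · rw [div_mul_cancel₀ _ h1]
      · ring
    · have h' : (ChainState.y₁ k' l' : ChainState K L) ≠ .y₁ k l := by
        simpa using h
      simp only [raiseRatio, chainProb, raise, if_neg h, if_neg h', one_mul]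

theorem compensated_log_raiseRatio (q : Fin K → Fin L → ℝ) (k : Fin K) (l : Fin L) {η κ : ℝ}
    (hp : 0 < q k l) (hη : 0 < η) (hpη : q k l + η < 1)
    (hκ : η ^ 2 ≤ κ * ((q k l + η) * (1 - (q k l + η)))) (s a) :
    0 ≤ (if s = .y₁ k l then κ else 0) +
      ∑ s', chainProb q s a s' * Real.log (raiseRatio k l (q k l) η s a s') := by
  by_cases h : s = .y₁ k l
  · subst h
    rw [sum_chainProb_y₁]
    simpa [raiseRatio] using neg_le_bernoulli_log hp hη hpη hκ
  · simp [raiseRatio, if_neg h]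

theorem numNearOpt_x (M₀ : MDP (ChainState K L) (ChainAction K L) γ) (β ε : ℝ) (k : Fin K)
    [DecidablePred fun l : Fin L =>
      l ∈ M₀.nearOptActions (.x k) (lowerGap β γ ε (M₀.optValue (.x k)))] :
    numNearOpt M₀ β ε (.x k) = (Finset.univ.filter fun l : Fin L =>
      l ∈ M₀.nearOptActions (.x k) (lowerGap β γ ε (M₀.optValue (.x k)))).card := by
  rw [← Set.ncard_coe_finset, Finset.coe_filter_univ]
  rfl

theorem totalNearOpt_le (M₀ : MDP (ChainState K L) (ChainAction K L) γ) (β ε : ℝ) :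
    totalNearOpt M₀ β ε ≤
      ∑ k : Fin K, if 2 ≤ numNearOpt M₀ β ε (.x k) then numNearOpt M₀ β ε (.x k) else 0 := by
  classical
  rw [← Finset.sum_filter, totalNearOpt]
  rw [← Finset.sum_image (f := fun s => numNearOpt M₀ β ε s) (g := ChainState.x (L := L))
    (fun _ _ _ _ h => by simpa using h)]
  refine Finset.sum_le_sum_of_subset fun s hs => ?_
  rw [Finset.mem_filter] at hs
  obtain ⟨-, hs1, hs2⟩ := hs
  cases s with
  | x k => exact Finset.mem_image_of_mem _ (by simpa using hs2)
  | y₁ k l => exact absurd (show Nontrivial Unit from hs1) (not_nontrivial Unit)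
  | y₂ k l => exact absurd (show Nontrivial Unit from hs1) (not_nontrivial Unit)

theorem epsZero_le (M₀ : MDP (ChainState K L) (ChainAction K L) γ) {β : ℝ} (hL : 2 ≤ L)
    (hβ : 0 ≤ β) (hγ0 : 0 ≤ γ) (hγ1 : γ < 1) (k : Fin K) :
    epsZero M₀ β ≤
      β * γ * M₀.optValue (.x k) ^ 2 / 16 * min (β / 2) ((1 - γ) / (3 * γ)) := by
  have hmin : 0 ≤ min (β / 2) ((1 - γ) / (3 * γ)) :=
    le_min (by positivity) (div_nonneg (by linarith) (by linarith))
  have hk : (.x k : ChainState K L) ∈ multiActionStates (ChainAction K L) :=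
    (Fin.nontrivial_iff_two_le.2 hL : Nontrivial (Fin L))
  have hinf : (⨅ s : multiActionStates (ChainAction K L), M₀.optValue s ^ 2) ≤
      M₀.optValue (.x k) ^ 2 := by
    refine ciInf_le (f := fun s : multiActionStates (ChainAction K L) => M₀.optValue s ^ 2)
      ⟨0, ?_⟩ ⟨_, hk⟩
    rintro _ ⟨s, rfl⟩
    exact sq_nonneg _
  rw [epsZero]
  gcongr

/-- In the prior model, the near-optimal actions can be moved to the common level and raised. -/
theorem reach_of_mem_nearOptActions [NeZero L] {q : Fin K → Fin L → ℝ}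
    (hq : ∀ k l, q k l ∈ Set.Ico (0 : ℝ) 1) (hγ0 : 0 < γ) (hγ1 : γ < 1) {β ε : ℝ} {k : Fin K}
    {l₀ : Fin L} (hl₀ : ∀ l, q k l ≤ q k l₀) {u η : ℝ} (h : IsLevel β γ ε (q k l₀) u η)
    {l : Fin L} (hl : l ∈ (chainMDP γ q hq).nearOptActions (.x k)
      (lowerGap β γ ε ((chainMDP γ q hq).optValue (.x k)))) : u + η ≤ q k l + β / 2 := by
  have hV := optValue_chainMDP_x hγ0.le hγ1 hq k hl₀
  have hQ : ∀ l, (chainMDP γ q hq).optQ (.x k) l = 1 / (1 - γ * q k l) :=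
    optQ_chainMDP_x hγ0.le hγ1 hq k
  have hpos : ∀ l, 0 < 1 - γ * q k l := fun l => one_sub_mul_pos hγ0.le hγ1 (hq k l).2.le
  rw [MDP.nearOptActions] at hl
  split_ifs at hl with hc
  · have hl' := (congrArg (fun z => (chainMDP γ q hq).optValue (.x k) - z) (hQ l)).symm.trans_lt hl
    rw [hV] at hl'
    exact h.reach _ (hq k l).1 (hq k l).2 hl'
  -- A nonpositive threshold leaves only the maximizers, whose self-loop probability is the best
  -- one.
  · have hl' := (hQ l₀).symm.trans_le ((hl l₀).trans_eq (hQ l))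
    rw [one_div_le_one_div (hpos _) (hpos _)] at hl'
    have h1 : q k l₀ ≤ q k l := le_of_mul_le_mul_left (by linarith) hγ0
    linarith [h.reach_best]

end Chain

/-! ### Counting the hard actions and the lower bound -/

/-- All but one of the near-optimal actions are output with probability at most `1/2`, so at least
half of the counted near-optimal actions are. -/
theorem totalNearOpt_le_two_mul_card {K L : ℕ} {γ : ℝ}
    (M₀ M : MDP (ChainState K L) (ChainAction K L) γ) (β ε : ℝ)
    (alg : Algorithm (ChainState K L) (ChainAction K L)) (F : Finset (Fin K × Fin L))
    (hF : ∀ k (l : Fin L), l ∈ M₀.nearOptActions (.x k) (lowerGap β γ ε (M₀.optValue (.x k))) →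
      alg.outputProb M {π | π (.x k) = l} ≤ 2⁻¹ → (k, l) ∈ F) :
    totalNearOpt M₀ β ε ≤ 2 * F.card := by
  classical
  have hcard : F.card = ∑ k, (Finset.univ.filter fun l => (k, l) ∈ F).card := by
    have h : F.card = (Finset.univ.filter fun x => x ∈ F).card := by simp
    rw [h]
    simp only [Finset.card_filter, Fintype.sum_prod_type]
  refine (totalNearOpt_le M₀ β ε).trans ?_
  rw [hcard, Finset.mul_sum]
  refine Finset.sum_le_sum fun k _ => ?_
  split_ifs with hk
  swap
  · exact Nat.zero_le _
  rw [numNearOpt_x] at hk ⊢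
  set N : Finset (Fin L) := Finset.univ.filter fun l : Fin L =>
    l ∈ M₀.nearOptActions (.x k) (lowerGap β γ ε (M₀.optValue (.x k))) with hN
  have h1 : (N.filter fun l => ¬ (k, l) ∈ F).card ≤ 1 := by
    rw [Finset.card_le_one]
    intro l hl l' hl'
    by_contra hne
    rw [Finset.mem_filter, hN, Finset.mem_filter_univ] at hl hl'
    have hd : Disjoint {π : Policy (ChainAction K L) | π (.x k) = l}
        {π : Policy (ChainAction K L) | π (.x k) = l'} :=
      Set.disjoint_left.2 fun π (h : π (.x k) = l) (h' : π (.x k) = l') => hne (h.symm.trans h')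
    rcases alg.outputProb_le_half_or M hd with h | h
    · exact hl.2 (hF k l hl.1 h)
    · exact hl'.2 (hF k l' hl'.1 h)
  have h2 : (N.filter fun l => (k, l) ∈ F).card ≤
      (Finset.univ.filter fun l => (k, l) ∈ F).card :=
    Finset.card_le_card (Finset.filter_subset_filter _ (Finset.subset_univ _))
  have h3 := Finset.card_filter_add_card_filter_not (s := N) fun l => (k, l) ∈ F
  -- At most one element of `N` is lost and `N` has at least two, so half of them remain; a state
  -- with a single near-optimal action could lose everything.
  omega

end TransferRL

theorem theorem2 :
    ∃ c : ℝ, 0 < c ∧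
      ∀ (K L : ℕ), 1 ≤ K → 2 ≤ L →
      ∀ (β γ : ℝ), 0 < β → β < 2 → max 0.4 (1 - 10 * β) < γ → γ < 1 →
      ∀ (q : Fin K → Fin L → ℝ) (hq : ∀ k l, q k l ∈ Set.Ico (0 : ℝ) 1),
        (∀ k, ∃ l, (4 * γ - 1) / (3 * γ) < q k l) →
      ∀ (ε δ : ℝ), 0 < ε → ε < epsZero (chainMDP γ q hq) β → 0 < δ → δ < 1 / 40 →
      ∀ alg : Algorithm (ChainState K L) (ChainAction K L),
        alg.IsCorrect (chainMDP γ q hq) β ε δ →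
        ∃ M ∈ (chainMDP γ q hq).tvBall β,
          ENNReal.ofReal (c * ((totalNearOpt (chainMDP γ q hq) β ε : ℝ) /
              ((1 - γ) ^ 3 * ε ^ 2) * Real.log (1 / δ))) ≤ alg.expectedSamples M := by
  classical
  -- The factors are `10 ^ 7` from `κ`, `10` from the change of measure and `2` from the count.
  refine ⟨1 / (2 * 10 ^ 8), by norm_num, ?_⟩
  intro K L _ hL β γ hβ0 hβ2 hγ hγ1 q hq hbest ε δ hε hε0 hδ0 hδ alg hcorrect
  have hγ0 : 0 < γ := by linarith [le_max_left (0.4 : ℝ) (1 - 10 * β)]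
  have hb : 0 < 1 - γ := by linarith
  have : NeZero L := ⟨by omega⟩
  choose l₀ hl₀ using fun k => Finite.exists_max (q k)
  have hlevel : ∀ k, ∃ u η, IsLevel β γ ε (q k (l₀ k)) u η := by
    intro k
    obtain ⟨l, hl⟩ := hbest k
    refine exists_isLevel hβ0 hβ2 hγ hγ1 (hq k _).2 (hl.trans_le (hl₀ k l)) hε ?_
    rw [← optValue_chainMDP_x hγ0.le hγ1 hq k (hl₀ k)]
    exact hε0.trans_le (epsZero_le _ hL hβ0.le hγ0.le hγ1 k)
  choose u η hu using hlevel
  set q' : Fin K → Fin L → ℝ := fun k l => levelProb β (u k) (η k) (q k l) with hq'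
  set ρ : Fin K → Fin L → ℝ := fun k l => levelScale γ β (u k) (η k) (q k l) with hρdef
  have hq'mem : ∀ k l, q' k l ∈ Set.Ico (0 : ℝ) 1 := fun k l =>
    (hu k).levelProb_mem hγ1 (hq k l) (hl₀ k l)
  have hρ : ∀ k l, ρ k l ∈ Set.Icc (0 : ℝ) 1 := fun k l =>
    ⟨(hu k).levelScale_nonneg hγ0.le hγ1 (hl₀ k l), (hu k).levelScale_le_one hγ0.le hγ1⟩
  have hρβ : ∀ k l, 1 - β ≤ ρ k l := fun k l =>
    (hu k).one_sub_le_levelScale hγ0.le hγ1 hβ0.le (hl₀ k l)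
  set M := scaledChain γ q' ρ hq'mem hρ with hM
  refine ⟨M, scaledChain_mem_tvBall hβ0.le hq hq'mem hρ
    (fun k l => (hu k).abs_sub_levelProb_le) hρβ, ?_⟩
  set κ : ℝ := 10 ^ 7 * (ε ^ 2 * (1 - γ) ^ 3) with hκ
  have hκ0 : 0 < κ := by positivity
  set F : Finset (Fin K × Fin L) := Finset.univ.filter fun x =>
    u x.1 + η x.1 ≤ q x.1 x.2 + β / 2 ∧
      alg.outputProb M {π | π (.x x.1) = x.2} ≤ 2⁻¹ with hF
  have hvisits : ∀ x ∈ F, ENNReal.ofReal (Real.log (1 / δ) / 10) ≤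
      ENNReal.ofReal κ * alg.expectedVisits M (.y₁ x.1 x.2) := by
    rintro ⟨k, l⟩ hx
    rw [hF, Finset.mem_filter_univ] at hx
    obtain ⟨hr, hhalf⟩ := hx
    have hpos : 0 < q' k l := (hu k).levelProb_pos hr
    have hlt : q' k l + η k < 1 := (hu k).levelProb_add_lt_one hγ1 (hl₀ k l) hr
    have hη := (hu k).incr_pos
    have hraise : ∀ k' l', raise q' k l (η k) k' l' ∈ Set.Ico (0 : ℝ) 1 := by
      intro k' l'
      rw [raise]
      split_ifs
      · exact ⟨by linarith, hlt⟩
      · exact hq'mem k' l'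
    have hball : scaledChain γ (raise q' k l (η k)) ρ hraise hρ ∈ (chainMDP γ q hq).tvBall β := by
      refine scaledChain_mem_tvBall hβ0.le hq hraise hρ (fun k' l' => ?_) hρβ
      rw [raise]
      split_ifs with h
      · obtain ⟨rfl, rfl⟩ := h
        exact (hu k').abs_sub_levelProb_add_le hr
      · exact (hu k').abs_sub_levelProb_le
    refine alg.log_le_mul_expectedVisits (M₀ := M)
      (M₁ := scaledChain γ (raise q' k l (η k)) ρ hraise hρ)
      (w := raiseRatio k l (q' k l) (η k)) (raiseRatio_pos k l hpos hη hlt)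
      (chainProb_raise q' k l hpos (hq'mem k l).2) rfl hκ0.le
      (compensated_log_raiseRatio q' k l hpos hη hlt
        ((hu k).incr_sq_le_mul hγ1 (hl₀ k l) hr)) hδ0 hδ ((hcorrect _ hball).trans ?_) hhalf
    refine alg.outputProb_mono _ fun π hπ => ?_
    -- In the raised model the rivals keep at most the value of the level, so every `ε`-optimal
    -- policy plays `l` at `x k`.
    refine IsEpsOptimal.action_eq hγ0.le hγ1 hraise hρ (fun l' hl' => ?_) hπ
    have h1 : raise q' k l (η k) k l' = q' k l' := by simp [raise, hl']
    have h2 : raise q' k l (η k) k l = q' k l + η k := by simp [raise]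
    rw [h1, h2]
    have h3 := (hu k).lt_raisedValue hγ0 hγ1 hε (hl₀ k l) hr
    have h4 := (hu k).levelValue_le hγ0.le hγ1 (hl₀ k l')
    exact lt_of_le_of_lt (by linarith) h3
  have hT : totalNearOpt (chainMDP γ q hq) β ε ≤ 2 * F.card := by
    refine totalNearOpt_le_two_mul_card _ M β ε alg F fun k l hl hhalf => ?_
    rw [hF, Finset.mem_filter_univ]
    exact ⟨reach_of_mem_nearOptActions hq hγ0 hγ1 (hl₀ k) (hu k) hl, hhalf⟩
  have hsum : (F.card : ENNReal) * ENNReal.ofReal (Real.log (1 / δ) / 10) ≤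
      ENNReal.ofReal κ * alg.expectedSamples M := by
    have h1 := Finset.sum_le_sum hvisits
    rw [Finset.sum_const, nsmul_eq_mul, ← Finset.mul_sum] at h1
    refine h1.trans ?_
    gcongr
    have h2 := alg.sum_expectedVisits_le M (F.image fun x => ChainState.y₁ x.1 x.2)
    rwa [Finset.sum_image fun x _ y _ h => by
      simpa [Prod.ext_iff] using h] at h2
  have hlog : 0 ≤ Real.log (1 / δ) := Real.log_nonneg (by rw [le_div_iff₀ hδ0]; linarith)
  rw [← ENNReal.mul_le_mul_iff_right (ENNReal.ofReal_pos.2 hκ0).ne' ENNReal.ofReal_ne_top]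
  refine le_trans ?_ hsum
  rw [← ENNReal.ofReal_mul hκ0.le, ← ENNReal.ofReal_natCast, ← ENNReal.ofReal_mul (by positivity)]
  apply ENNReal.ofReal_le_ofReal
  have hT' : (totalNearOpt (chainMDP γ q hq) β ε : ℝ) ≤ 2 * F.card := by exact_mod_cast hT
  calc κ * (1 / (2 * 10 ^ 8) * ((totalNearOpt (chainMDP γ q hq) β ε : ℝ) /
        ((1 - γ) ^ 3 * ε ^ 2) * Real.log (1 / δ)))
      = (totalNearOpt (chainMDP γ q hq) β ε : ℝ) * (Real.log (1 / δ) / 20) := by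
        rw [hκ]
        field_simp
        ring
    _ ≤ 2 * F.card * (Real.log (1 / δ) / 20) := by gcongr
    _ = F.card * (Real.log (1 / δ) / 10) := by ring
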